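/- Theorem 3.1. Let $p_0>0$ be a probability density on $\mathbb R^n$ such that $g(x)=-\log p_0(x)-\frac{|x|^2}{2}$ belongs to $C^2(\mathbb R^n)$. Let $(X_t)_{t\ge 0}$ be the Ornstein–Uhlenbeck process $dX_t=-\frac12 X_t\,dt+dW_t$, where $W$ is a standard Brownian motion in $\mathbb R^n$ independent of $X_0$ and $X_0$ has density $p_0$. Then every $X_t$, $t\ge 0$, has a (unique) continuous density $p(t,\cdot)$, with $p(0,\cdot)=p_0$; it is positive, and $q(t,x)=-\log p(t,x)-\frac{|x|^2}{2}$ is $C^2$ in $x$, with $q(0,\cdot)=g$. Write $D^2$ for the Hessian in $x$, $I$ for the identity matrix, and $A\preceq B$ when $B-A$ is positive semidefinite. Then: (1) If $M_1\in\mathbb R$ and $D^2g(x)\preceq M_1 I$ for all $x\in\mathbb R^n$, then $D^2q(t,x)\preceq e^{-t}M_1 I$ for all $t\ge 0$ and $x\in\mathbb R^n$. (2) If $M_0\ge 0$ and $D^2g(x)\succeq -M_0 I$ for all $x\in\mathbb R^n$, then $$D^2q(t,x)\succeq-\frac{M_0}{e^t-M_0(e^t-1)}\,I\qquad\text{for all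 }x\in\mathbb R^n$$ and all $0\le t<-\log\left(1-\frac1{M_0}\right)$, where this upper limit is read as $+\infty$ if $M_0\le 1$. -/

import Mathlib

open MeasureTheory ProbabilityTheory
open scoped NNReal ENNReal MatrixOrder

/-- The Hessian matrix `D²f(x)` of a function on `ℝⁿ`, with entries `∂ᵢ∂ⱼ f(x)`. -/
noncomputable def hessian {n : ℕ} (f : EuclideanSpace ℝ (Fin n) → ℝ)
    (x : EuclideanSpace ℝ (Fin n)) : Matrix (Fin n) (Fin n) ℝ :=
  Matrix.of fun i j =>
    iteratedFDeriv ℝ 2 f x ![EuclideanSpace.single i 1, EuclideanSpace.single j 1]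

/-- The potential `-log r(x) - |x|²/2` of a density `r`, that is, the non-Gaussian part of its
negative log-likelihood. -/
noncomputable def scorePotential {n : ℕ} (r : EuclideanSpace ℝ (Fin n) → ℝ)
    (x : EuclideanSpace ℝ (Fin n)) : ℝ :=
  -Real.log (r x) - ‖x‖ ^ 2 / 2

/-- Standard Brownian motion in `ℝⁿ`: the coordinate processes are independent standard real
Brownian motions. -/
structure IsBrownianVec {n : ℕ} {Ω : Type*} [MeasurableSpace Ω]
    (W : ℝ≥0 → Ω → EuclideanSpace ℝ (Fin n)) (P : Measure Ω) : Prop where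
  measurable : ∀ t, Measurable (W t)
  coord : ∀ i, IsBrownianReal (fun t ω => W t ω i) P
  indep : iIndepFun (fun (i : Fin n) (ω : Ω) (t : ℝ≥0) => W t ω i) P

/-- `X` is an Ornstein-Uhlenbeck process: a continuous solution of `dX = -(1/2) X dt + dW`,
driven by the Brownian motion `W`, whose initial value is independent of `W` and has the
probability density `p₀`. The noise is additive, so the equation is read along paths, in its
integrated form. When `P` is a probability measure, `initial_law` forces `∫ p₀ = 1`. -/
structure IsOrnsteinUhlenbeck {n : ℕ} {Ω : Type*} [MeasurableSpace Ω]
    (X W : ℝ≥0 → Ω → EuclideanSpace ℝ (Fin n)) (p₀ : EuclideanSpace ℝ (Fin n) → ℝ)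
    (P : Measure Ω) : Prop where
  brownian : IsBrownianVec W P
  measurable : ∀ t, Measurable (X t)
  initial_law : HasLaw (X 0) (volume.withDensity fun x => ENNReal.ofReal (p₀ x)) P
  initial_indep : IndepFun (X 0) (fun ω t => W t ω) P
  continuous_path : ∀ᵐ ω ∂P, Continuous fun t => X t ω
  equation : ∀ᵐ ω ∂P, ∀ t : ℝ≥0,
    X t ω = X 0 ω - (1 / 2 : ℝ) • (∫ s in (0 : ℝ)..t, X s.toNNReal ω) + W t ω

/-- `p t` is, for every time `t`, the continuous probability density of `X t`. A continuous
density is determined at every point by the law; in particular `p 0` is the initial density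
when that one is continuous. -/
structure IsMarginalDensity {n : ℕ} {Ω : Type*} [MeasurableSpace Ω]
    (p : ℝ≥0 → EuclideanSpace ℝ (Fin n) → ℝ) (X : ℝ≥0 → Ω → EuclideanSpace ℝ (Fin n))
    (P : Measure Ω) : Prop where
  continuous : ∀ t, Continuous (p t)
  nonneg : ∀ t x, 0 ≤ p t x
  law : ∀ t, HasLaw (X t) (volume.withDensity fun x => ENNReal.ofReal (p t x)) P

/-!
By Duhamel's formula, `X_t = exp (-t / 2) • X_0 + N_t`, where `N_t` is a Gaussian vector independent
of `X_0` with covariance `s • 1`, `s = 1 - exp (-t)`. Along a path, the noise `N_t` is obtained as a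
limit of Riemann sums `noiseSum` of Brownian increments (`tendsto_noiseSum`), whose characteristic
functions are explicit (`charFun_noiseSum`); so no stochastic integral is needed to identify the law
of `X_t` (`IsOrnsteinUhlenbeck.map_eq`). Its density is `smoothedDensity`, the initial law smoothed
by a heat kernel, hence positive and `C²`.

Put `a = exp (-t / 2)`, so that `a ^ 2 + s = 1`. Completing the square makes the Gaussian factor
split off: `exp (-q(t, x)) = E[exp (-g (a • x + √s • Z))]` with `Z` a standard Gaussian vector
(`ofReal_exp_neg_scorePotential_smoothedDensity`). For `C²` functions, bounds on the Hessian are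
equivalent to bounds on symmetric second differences (`forall_hessian_le_iff`,
`forall_le_hessian_iff`), and these pass through the expectation without differentiating under it.

* For the upper bound, the Cauchy–Schwarz inequality bounds the square of the expectation at `x` by
  the product of its values at `x + h` and `x - h` (`gaussianTransform_sq_le`).
* For the lower bound, the expectation is an integral over `y` of
  `exp (-g y - ‖y - a • x‖ ^ 2 / (2 * s))`, and the Prékopa–Leindler inequality
  (`prekopaLeindler`) applies, because `g y + ‖y - a • x‖ ^ 2 / (2 * s) + K * ‖x‖ ^ 2 / 2` is
  jointly convex in `(x, y)` as soon as `M₀ * s < 1` and `K = M₀ * a ^ 2 / (1 - M₀ * s)`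
  (`gaussianTransform_mul_le`). The condition `M₀ * s < 1` is the time horizon of the theorem, and
  `K` is the constant in its conclusion.

The Prékopa–Leindler inequality is proved here for midpoints, from the one-dimensional
Brunn–Minkowski inequality and by induction on the dimension.
-/

/-! ### The Prékopa–Leindler inequality -/

lemma volume_preimage_two_mul_sub (c : ℝ) (A : Set ℝ) :
    2 * volume ((fun x => 2 * x - c) ⁻¹' A) = volume A := by
  have h : (fun x : ℝ => 2 * x - c) ⁻¹' A
      = (fun x => 2 * x) ⁻¹' ((fun x => x + -c) ⁻¹' A) := by
    ext x; simp [sub_eq_add_neg]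
  rw [h, Real.volume_preimage_mul_left two_ne_zero, measure_preimage_add_right, ← mul_assoc,
    show (2 : ℝ≥0∞) = ENNReal.ofReal 2 by simp, ← ENNReal.ofReal_mul (by norm_num)]
  norm_num

/-- Two compact subsets of the line, translated so that they share only the maximum of one and the
minimum of the other, both fit into the doubled set of midpoints. -/
lemma volume_add_volume_le_of_isCompact {A B C : Set ℝ} (hA : IsCompact A) (hB : IsCompact B)
    (hA' : A.Nonempty) (hB' : B.Nonempty) (hC : ∀ a ∈ A, ∀ b ∈ B, (a + b) / 2 ∈ C) :
    volume A + volume B ≤ 2 * volume C := by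
  obtain ⟨a, ha, haA⟩ := hA.exists_isGreatest hA'
  obtain ⟨b, hb, hbB⟩ := hB.exists_isLeast hB'
  set S := (fun x => 2 * x - b) ⁻¹' A with hS
  set T := (fun x => 2 * x - a) ⁻¹' B with hT
  have hST : S ∪ T ⊆ C := by
    rintro x (hx | hx)
    · have := hC _ hx b hb
      simpa using this
    · have := hC a ha _ hx
      simpa using this
  have hTm : MeasurableSet T := hB.measurableSet.preimage (by fun_prop)
  have hd : AEDisjoint volume S T := by
    refine measure_mono_null (t := {(a + b) / 2}) ?_ (by simp)
    rintro x ⟨h1, h2⟩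
    have h3 := haA h1
    have h4 := hbB h2
    simp only [Set.mem_singleton_iff]
    linarith
  calc volume A + volume B = 2 * (volume S + volume T) := by
        rw [mul_add, volume_preimage_two_mul_sub, volume_preimage_two_mul_sub]
    _ = 2 * volume (S ∪ T) := by rw [measure_union₀ hTm.nullMeasurableSet hd]
    _ ≤ 2 * volume C := by gcongr

/-- The one-dimensional Brunn–Minkowski inequality, for the set of midpoints. -/
lemma volume_add_volume_le {A B C : Set ℝ} (hA : MeasurableSet A) (hB : MeasurableSet B)
    (hA' : A.Nonempty) (hB' : B.Nonempty) (hC : ∀ a ∈ A, ∀ b ∈ B, (a + b) / 2 ∈ C) :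
    volume A + volume B ≤ 2 * volume C := by
  obtain ⟨a, ha⟩ := hA'
  obtain ⟨b, hb⟩ := hB'
  rw [hA.measure_eq_iSup_isCompact, hB.measure_eq_iSup_isCompact]
  simp only [iSup_and', ← exists_prop]
  refine ENNReal.biSup_add_biSup_le' ⟨∅, by simp⟩ ⟨∅, by simp⟩ ?_
  rintro K ⟨hK, hKc⟩ K' ⟨hK', hKc'⟩
  calc volume K + volume K' ≤ volume (insert a K) + volume (insert b K') := by
        gcongr <;> exact Set.subset_insert _ _
    _ ≤ 2 * volume C := by
        refine volume_add_volume_le_of_isCompact (hKc.insert a) (hKc'.insert b) (by simp)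
          (by simp) fun x hx y hy => hC x ?_ y ?_
        · rcases hx with rfl | hx
          exacts [ha, hK hx]
        · rcases hy with rfl | hy
          exacts [hb, hK' hy]

/-- The layer cake formula for functions with values in `[0, ∞]`. -/
lemma lintegral_eq_lintegral_volume_lt {α : Type*} [MeasurableSpace α] (μ : Measure α) [SFinite μ]
    {u : α → ℝ≥0∞} (hu : Measurable u) :
    ∫⁻ x, u x ∂μ = ∫⁻ t in Set.Ioi (0 : ℝ), μ {x | ENNReal.ofReal t < u x} := by
  have hm : MeasurableSet {p : α × ℝ | ENNReal.ofReal p.2 < u p.1} :=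
    measurableSet_lt (by fun_prop) (by fun_prop)
  have h1 : ∀ c : ℝ≥0∞, (volume.restrict (Set.Ioi (0 : ℝ))) {t | ENNReal.ofReal t < c} = c := by
    intro c
    have hcm : MeasurableSet {t : ℝ | ENNReal.ofReal t < c} :=
      measurableSet_lt (by fun_prop) (by fun_prop)
    rw [Measure.restrict_apply hcm]
    induction c with
    | top => simp
    | coe r =>
      have : {t : ℝ | ENNReal.ofReal t < r} ∩ Set.Ioi 0 = Set.Ioo 0 (r : ℝ) := by
        ext t
        simp only [Set.mem_inter_iff, Set.mem_ofPred_eq, Set.mem_Ioi, Set.mem_Ioo]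
        constructor
        · rintro ⟨h, h0⟩
          refine ⟨h0, ?_⟩
          have := (ENNReal.ofReal_lt_iff_lt_toReal h0.le ENNReal.coe_ne_top).1 h
          simpa using this
        · rintro ⟨h0, h⟩
          exact ⟨(ENNReal.ofReal_lt_iff_lt_toReal h0.le ENNReal.coe_ne_top).2 (by simpa), h0⟩
      rw [this, Real.volume_Ioo, sub_zero, ENNReal.ofReal_coe_nnreal]
  calc ∫⁻ x, u x ∂μ
      = ∫⁻ x, (volume.restrict (Set.Ioi (0 : ℝ))) (Prod.mk x ⁻¹' {p | ENNReal.ofReal p.2 < u p.1})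
          ∂μ := lintegral_congr fun x => (h1 (u x)).symm
    _ = (μ.prod (volume.restrict (Set.Ioi (0 : ℝ)))) {p | ENNReal.ofReal p.2 < u p.1} :=
        (Measure.prod_apply hm).symm
    _ = _ := Measure.prod_apply_symm hm

lemma ENNReal.mul_le_sq_of_add_le_two_mul {a b c : ℝ≥0∞} (h : a + b ≤ 2 * c) : a * b ≤ c ^ 2 := by
  rcases eq_or_ne c ∞ with rfl | hc
  · simp
  have hab : a + b ≠ ∞ := ne_top_of_le_ne_top (ENNReal.mul_ne_top (by simp) hc) h
  rw [ENNReal.add_ne_top] at hab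
  lift c to ℝ≥0 using hc
  lift a to ℝ≥0 using hab.1
  lift b to ℝ≥0 using hab.2
  have h' : (a : ℝ) + b ≤ 2 * c := by exact_mod_cast h
  have : (a : ℝ) * b ≤ c ^ 2 := by
    nlinarith [sq_nonneg ((a : ℝ) - b), a.coe_nonneg, b.coe_nonneg, c.coe_nonneg]
  exact_mod_cast this

/-- When `f` and `g` have supremum one, for every `t < 1` both superlevel sets at height `t` are
nonempty and their midpoints lie in that of `h`; above height one there is nothing to compare. -/
lemma lintegral_add_lintegral_le_of_iSup_eq_one {f g h : ℝ → ℝ≥0∞} (hf : Measurable f)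
    (hg : Measurable g) (hh : Measurable h) (hf1 : ⨆ x, f x = 1) (hg1 : ⨆ x, g x = 1)
    (H : ∀ x y, f x * g y ≤ h ((x + y) / 2) ^ 2) :
    (∫⁻ x, f x) + ∫⁻ x, g x ≤ 2 * ∫⁻ x, h x := by
  rw [lintegral_eq_lintegral_volume_lt _ hf, lintegral_eq_lintegral_volume_lt _ hg,
    lintegral_eq_lintegral_volume_lt _ hh, ← lintegral_const_mul', ← lintegral_add_left']
  rotate_left
  · refine Antitone.measurable ?_ |>.aemeasurable
    intro s t hst
    exact measure_mono fun x hx => lt_of_le_of_lt (ENNReal.ofReal_le_ofReal hst) hx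
  · simp
  refine lintegral_mono fun t => ?_
  simp only
  rcases le_or_gt 1 (ENNReal.ofReal t) with ht | ht
  · have h1 : {x | ENNReal.ofReal t < f x} = ∅ := by
      ext x; simpa using (le_iSup f x).trans (hf1.le.trans ht)
    have h2 : {x | ENNReal.ofReal t < g x} = ∅ := by
      ext x; simpa using (le_iSup g x).trans (hg1.le.trans ht)
    simp [h1, h2]
  · refine volume_add_volume_le (measurableSet_lt (by fun_prop) hf)
      (measurableSet_lt (by fun_prop) hg) ?_ ?_ ?_
    · obtain ⟨x, hx⟩ := lt_iSup_iff.1 (ht.trans_eq hf1.symm)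
      exact ⟨x, hx⟩
    · obtain ⟨x, hx⟩ := lt_iSup_iff.1 (ht.trans_eq hg1.symm)
      exact ⟨x, hx⟩
    · intro a ha b hb
      have h1 : ENNReal.ofReal t ^ 2 < h ((a + b) / 2) ^ 2 :=
        lt_of_lt_of_le (by rw [sq]; exact ENNReal.mul_lt_mul ha hb) (H a b)
      exact lt_of_pow_lt_pow_left' 2 h1

lemma prekopaLeindler_real_of_iSup_ne_top {f g h : ℝ → ℝ≥0∞} (hf : Measurable f)
    (hg : Measurable g) (hh : Measurable h) (hf1 : ⨆ x, f x ≠ ∞) (hg1 : ⨆ x, g x ≠ ∞)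
    (H : ∀ x y, f x * g y ≤ h ((x + y) / 2) ^ 2) :
    (∫⁻ x, f x) * ∫⁻ x, g x ≤ (∫⁻ x, h x) ^ 2 := by
  set M := ⨆ x, f x with hM
  set N := ⨆ x, g x with hN
  rcases eq_or_ne M 0 with hM0 | hM0
  · have : ∀ x, f x = 0 := fun x => nonpos_iff_eq_zero.1 (hM0 ▸ le_iSup f x)
    simp [this]
  rcases eq_or_ne N 0 with hN0 | hN0
  · have : ∀ x, g x = 0 := fun x => nonpos_iff_eq_zero.1 (hN0 ▸ le_iSup g x)
    simp [this]
  -- dividing `f`, `g` by their suprema and `h` by the geometric mean of these keeps the hypothesis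
  obtain ⟨c, hc⟩ : ∃ c : ℝ≥0∞, c ^ 2 = M⁻¹ * N⁻¹ :=
    ⟨(M⁻¹ * N⁻¹) ^ ((1 : ℝ) / 2), by
      rw [← ENNReal.rpow_natCast, ← ENNReal.rpow_mul]; norm_num⟩
  have key := lintegral_add_lintegral_le_of_iSup_eq_one (f := fun x => M⁻¹ * f x)
    (g := fun x => N⁻¹ * g x) (h := fun x => c * h x) (by fun_prop) (by fun_prop) (by fun_prop)
    (by rw [← ENNReal.mul_iSup, ← hM, ENNReal.inv_mul_cancel hM0 hf1])
    (by rw [← ENNReal.mul_iSup, ← hN, ENNReal.inv_mul_cancel hN0 hg1])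
    (fun x y => by
      rw [mul_pow, hc, mul_mul_mul_comm]
      gcongr
      exact H x y)
  have key2 := ENNReal.mul_le_sq_of_add_le_two_mul key
  rw [lintegral_const_mul _ hf, lintegral_const_mul _ hg, lintegral_const_mul _ hh, mul_pow, hc,
    mul_mul_mul_comm] at key2
  refine (ENNReal.mul_le_mul_iff_right ?_ ?_).1 key2
  · exact mul_ne_zero (ENNReal.inv_ne_zero.2 hf1) (ENNReal.inv_ne_zero.2 hg1)
  · exact ENNReal.mul_ne_top (ENNReal.inv_ne_top.2 hM0) (ENNReal.inv_ne_top.2 hN0)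

/-- Unbounded functions are treated by truncating at integer heights. -/
lemma prekopaLeindler_real {f g h : ℝ → ℝ≥0∞} (hf : Measurable f)
    (hg : Measurable g) (hh : Measurable h) (H : ∀ x y, f x * g y ≤ h ((x + y) / 2) ^ 2) :
    (∫⁻ x, f x) * ∫⁻ x, g x ≤ (∫⁻ x, h x) ^ 2 := by
  have htrunc : ∀ u : ℝ → ℝ≥0∞, Measurable u →
      ∫⁻ x, u x = ⨆ k : ℕ, ∫⁻ x, min (u x) k := by
    intro u hu
    rw [← lintegral_iSup (f := fun (k : ℕ) x => min (u x) (k : ℝ≥0∞))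
      (fun k => hu.min measurable_const)
      (fun i j hij x => min_le_min_left _ (by exact_mod_cast hij))]
    refine lintegral_congr fun x => ?_
    have : (⨆ k : ℕ, min (u x) (k : ℝ≥0∞)) = min (u x) (⨆ k : ℕ, (k : ℝ≥0∞)) :=
      (inf_iSup_eq _ _).symm
    rw [this, ENNReal.iSup_natCast]
    simp
  have hbd : ∀ (u : ℝ → ℝ≥0∞) (k : ℕ), ⨆ x, min (u x) (k : ℝ≥0∞) ≠ ∞ := fun u k =>
    ne_top_of_le_ne_top (ENNReal.natCast_ne_top k) (iSup_le fun x => min_le_right _ _)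
  rw [htrunc f hf, htrunc g hg, ENNReal.iSup_mul]
  refine iSup_le fun k => ?_
  rw [ENNReal.mul_iSup]
  refine iSup_le fun l => ?_
  exact prekopaLeindler_real_of_iSup_ne_top (hf.min measurable_const)
    (hg.min measurable_const) hh (hbd f k) (hbd g l)
    fun x y => le_trans (mul_le_mul' (min_le_left _ _) (min_le_left _ _)) (H x y)

/-- The Prékopa–Leindler inequality for midpoints. Integrating out one variable turns the
hypothesis in dimension `n + 1` into the hypothesis in dimension `n`. -/
theorem prekopaLeindler_pi {n : ℕ} {f g h : (Fin n → ℝ) → ℝ≥0∞} (hf : Measurable f)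
    (hg : Measurable g) (hh : Measurable h)
    (H : ∀ x y, f x * g y ≤ h ((1 / 2 : ℝ) • (x + y)) ^ 2) :
    (∫⁻ x, f x) * ∫⁻ x, g x ≤ (∫⁻ x, h x) ^ 2 := by
  induction n with
  | zero =>
    rw [lintegral_unique, lintegral_unique, lintegral_unique]
    have h1 : volume (Set.univ : Set (Fin 0 → ℝ)) = 1 := by simp [volume_pi]
    rw [h1, mul_one, mul_one, mul_one]
    convert H default default using 3
  | succ n ih =>
    have hfub : ∀ u : (Fin (n + 1) → ℝ) → ℝ≥0∞, Measurable u →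
        ∫⁻ x, u x = ∫⁻ y : Fin n → ℝ, ∫⁻ s : ℝ, u (Fin.cons s y) := by
      intro u hu
      have e := (volume_preserving_piFinSuccAbove (fun _ : Fin (n + 1) => ℝ) 0).symm
      rw [← e.lintegral_comp hu, Measure.volume_eq_prod, lintegral_prod_symm']
      · simp [MeasurableEquiv.piFinSuccAbove, Fin.consEquiv]
      · exact hu.comp e.measurable
    have hm : Measurable fun p : ℝ × (Fin n → ℝ) => (Fin.cons p.1 p.2 : Fin (n + 1) → ℝ) := by
      refine measurable_pi_lambda _ fun i => ?_
      refine Fin.cases ?_ (fun j => ?_) i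
      · simpa using measurable_fst
      · simp only [Fin.cons_succ]; fun_prop
    have hslice : ∀ (u : (Fin (n + 1) → ℝ) → ℝ≥0∞), Measurable u → ∀ y : Fin n → ℝ,
        Measurable fun s : ℝ => u (Fin.cons s y) := fun u hu y =>
      (hu.comp hm).comp (measurable_id.prodMk measurable_const)
    rw [hfub f hf, hfub g hg, hfub h hh]
    refine ih ?_ ?_ ?_ fun x y => ?_
    · exact (hf.comp hm).lintegral_prod_left'
    · exact (hg.comp hm).lintegral_prod_left'
    · exact (hh.comp hm).lintegral_prod_left'
    · refine prekopaLeindler_real (hslice f hf x) (hslice g hg y) (hslice h hh _) fun s t => ?_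
      convert H (Fin.cons s x) (Fin.cons t y) using 3
      ext i
      refine Fin.cases ?_ (fun j => ?_) i
      · simp; ring
      · simp; ring

/-- The Prékopa–Leindler inequality for midpoints, on Euclidean space. -/
theorem prekopaLeindler {n : ℕ} {f g h : EuclideanSpace ℝ (Fin n) → ℝ≥0∞} (hf : Measurable f)
    (hg : Measurable g) (hh : Measurable h)
    (H : ∀ x y, f x * g y ≤ h ((1 / 2 : ℝ) • (x + y)) ^ 2) :
    (∫⁻ x, f x) * ∫⁻ x, g x ≤ (∫⁻ x, h x) ^ 2 := by
  have e := PiLp.volume_preserving_toLp (Fin n)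
  rw [← e.lintegral_comp hf, ← e.lintegral_comp hg, ← e.lintegral_comp hh]
  exact prekopaLeindler_pi (hf.comp e.measurable) (hg.comp e.measurable) (hh.comp e.measurable)
    fun x y => by simpa using H (WithLp.toLp 2 x) (WithLp.toLp 2 y)

/-! ### Hessians and symmetric second differences -/

lemma second_difference_le_of_second_deriv_le {φ φ' φ'' : ℝ → ℝ}
    (h1 : ∀ s, HasDerivAt φ (φ' s) s) (h2 : ∀ s, HasDerivAt φ' (φ'' s) s) {c r : ℝ} (hr : 0 ≤ r)
    (hc : ∀ s ∈ Set.Icc (-r) r, φ'' s ≤ c) : φ r + φ (-r) - 2 * φ 0 ≤ c * r ^ 2 := by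
  have hA : AntitoneOn (fun s => φ' s - c * s) (Set.Icc (-r) r) := by
    have hd : ∀ s, HasDerivAt (fun s => φ' s - c * s) (φ'' s - c * 1) s := fun s =>
      (h2 s).sub ((hasDerivAt_id s).const_mul c)
    refine antitoneOn_of_deriv_nonpos (convex_Icc _ _)
      (fun s _ => (hd s).continuousAt.continuousWithinAt)
      (fun s _ => (hd s).differentiableAt.differentiableWithinAt) fun s hs => ?_
    rw [(hd s).deriv]
    linarith [hc s (interior_subset hs)]
  have hB : AntitoneOn (fun s => φ s + φ (-s) - c * s ^ 2) (Set.Icc 0 r) := by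
    have hd : ∀ s, HasDerivAt (fun s => φ s + φ (-s) - c * s ^ 2)
        (φ' s + φ' (-s) * (-1) - c * (2 * s)) s := fun s => by
      have e1 : HasDerivAt (fun s => φ (-s)) (φ' (-s) * (-1)) s :=
        (h1 (-s)).comp s (hasDerivAt_neg s)
      have e2 : HasDerivAt (fun s : ℝ => c * s ^ 2) (c * (2 * s)) s := by
        simpa using (hasDerivAt_pow 2 s).const_mul c
      exact ((h1 s).add e1).sub e2
    refine antitoneOn_of_deriv_nonpos (convex_Icc _ _)
      (fun s _ => (hd s).continuousAt.continuousWithinAt)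
      (fun s _ => (hd s).differentiableAt.differentiableWithinAt) fun s hs => ?_
    rw [(hd s).deriv]
    have hs' := interior_subset hs
    have := hA (a := -s) ⟨by linarith [hs'.2], by linarith [hs'.1, hs'.2]⟩
      (b := s) ⟨by linarith [hs'.1], hs'.2⟩ (by linarith [hs'.1])
    simp only at this
    linarith
  have := hB (a := 0) ⟨le_rfl, hr⟩ (b := r) ⟨hr, le_rfl⟩ hr
  simp only [neg_zero] at this
  linarith

/-- If `φ'' 0` exceeded `c`, so would `φ''` near `0`, and small second differences would exceed
`c * r ^ 2`. -/
lemma second_deriv_le_of_second_difference_le {φ φ' φ'' : ℝ → ℝ}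
    (h1 : ∀ s, HasDerivAt φ (φ' s) s) (h2 : ∀ s, HasDerivAt φ' (φ'' s) s)
    (h3 : ContinuousAt φ'' 0) {c : ℝ} (hc : ∀ r, φ r + φ (-r) - 2 * φ 0 ≤ c * r ^ 2) :
    φ'' 0 ≤ c := by
  by_contra! hlt
  obtain ⟨c', hc1, hc2⟩ := exists_between hlt
  obtain ⟨δ, hδ, hball⟩ := Metric.eventually_nhds_iff.1 (h3.eventually_const_lt hc2)
  have hr : 0 < δ / 2 := by positivity
  have := second_difference_le_of_second_deriv_le (φ := fun s => -φ s) (φ' := fun s => -φ' s)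
    (φ'' := fun s => -φ'' s) (c := -c') (fun s => (h1 s).neg) (fun s => (h2 s).neg) hr.le
    (fun s hs => by
      have : dist s 0 < δ := by
        rw [Real.dist_eq, sub_zero]
        exact lt_of_le_of_lt (abs_le.2 hs) (by linarith)
      linarith [hball this])
  have h5 := hc (δ / 2)
  nlinarith [pow_pos hr 2]

section Line

variable {E : Type*} [NormedAddCommGroup E] [NormedSpace ℝ E] {f : E → ℝ}

lemma hasDerivAt_line (hf : ContDiff ℝ 2 f) (x v : E) (s : ℝ) :
    HasDerivAt (fun s : ℝ => f (x + s • v)) (fderiv ℝ f (x + s • v) v) s := by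
  have h := (hf.differentiable (by norm_num) (x + s • v)).hasFDerivAt
  have hl : HasDerivAt (fun s : ℝ => x + s • v) v s := by
    simpa using ((hasDerivAt_id s).smul_const v).const_add x
  exact h.comp_hasDerivAt s hl

lemma hasDerivAt_fderiv_line (hf : ContDiff ℝ 2 f) (x v : E) (s : ℝ) :
    HasDerivAt (fun s : ℝ => fderiv ℝ f (x + s • v) v)
      (fderiv ℝ (fderiv ℝ f) (x + s • v) v v) s := by
  have hf' : ContDiff ℝ 1 (fderiv ℝ f) := hf.fderiv_right (by norm_num)
  have h := (hf'.differentiable (by norm_num) (x + s • v)).hasFDerivAt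
  have hl : HasDerivAt (fun s : ℝ => x + s • v) v s := by
    simpa using ((hasDerivAt_id s).smul_const v).const_add x
  have h3 : HasDerivAt (fun s : ℝ => fderiv ℝ f (x + s • v))
      (fderiv ℝ (fderiv ℝ f) (x + s • v) v) s := h.comp_hasDerivAt s hl
  have h4 := h3.clm_apply (hasDerivAt_const s v)
  simpa only [map_zero, add_zero] using h4

lemma continuous_fderiv_fderiv_line (hf : ContDiff ℝ 2 f) (x v : E) :
    Continuous fun s : ℝ => fderiv ℝ (fderiv ℝ f) (x + s • v) v v := by
  have hf' : ContDiff ℝ 1 (fderiv ℝ f) := hf.fderiv_right (by norm_num)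
  have := hf'.continuous_fderiv (by norm_num)
  fun_prop

/-- For a `C²` function, an upper bound on the second derivative is the same as an upper bound on
all symmetric second differences. -/
lemma forall_fderiv_fderiv_le_iff (hf : ContDiff ℝ 2 f) {M : ℝ} :
    (∀ x v, fderiv ℝ (fderiv ℝ f) x v v ≤ M * ‖v‖ ^ 2) ↔
      ∀ x v, f (x + v) + f (x - v) - 2 * f x ≤ M * ‖v‖ ^ 2 := by
  constructor
  · intro H x v
    have := second_difference_le_of_second_deriv_le (hasDerivAt_line hf x v)
      (hasDerivAt_fderiv_line hf x v) zero_le_one (c := M * ‖v‖ ^ 2) fun s _ => H _ v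
    simpa [sub_eq_add_neg] using this
  · intro H x v
    have := second_deriv_le_of_second_difference_le (hasDerivAt_line hf x v)
      (hasDerivAt_fderiv_line hf x v) (continuous_fderiv_fderiv_line hf x v).continuousAt
      (c := M * ‖v‖ ^ 2) fun r => by
        have := H x (r • v)
        rw [norm_smul, mul_pow, Real.norm_eq_abs, sq_abs] at this
        simp only [neg_smul, zero_smul, add_zero, ← sub_eq_add_neg]
        linarith
    simpa using this

end Line

section Hessian

variable {n : ℕ} {f : EuclideanSpace ℝ (Fin n) → ℝ}

lemma dotProduct_hessian_mulVec (x v : EuclideanSpace ℝ (Fin n)) :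
    v.ofLp ⬝ᵥ (hessian f x).mulVec v.ofLp = fderiv ℝ (fderiv ℝ f) x v v := by
  have hv : v = ∑ i, v i • EuclideanSpace.single i (1 : ℝ) := by
    simpa using ((EuclideanSpace.basisFun (Fin n) ℝ).sum_repr v).symm
  conv_rhs => rw [hv]
  simp only [map_sum, map_smul, sum_apply, smul_apply,
    dotProduct, Matrix.mulVec, hessian, Matrix.of_apply, iteratedFDeriv_two_apply,
    Matrix.cons_val_zero, Matrix.cons_val_one, smul_eq_mul, Finset.mul_sum]
  rw [Finset.sum_comm]
  refine Finset.sum_congr rfl fun i _ => Finset.sum_congr rfl fun j _ => ?_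
  ring

lemma isHermitian_hessian (hf : ContDiff ℝ 2 f) (x : EuclideanSpace ℝ (Fin n)) :
    (hessian f x).IsHermitian := by
  have hs : IsSymmSndFDerivAt ℝ f x := hf.contDiffAt.isSymmSndFDerivAt (by simp)
  ext i j
  simpa [hessian, iteratedFDeriv_two_apply] using hs.eq _ _

/-- `hessian f ≤ M • 1` everywhere, expressed through symmetric second differences. -/
lemma forall_hessian_le_iff (hf : ContDiff ℝ 2 f) {M : ℝ} :
    (∀ x, hessian f x ≤ M • 1) ↔ ∀ x v, f (x + v) + f (x - v) - 2 * f x ≤ M * ‖v‖ ^ 2 := by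
  rw [← forall_fderiv_fderiv_le_iff hf]
  refine forall_congr' fun x => ?_
  have key : ∀ v : EuclideanSpace ℝ (Fin n),
      star v.ofLp ⬝ᵥ (M • (1 : Matrix (Fin n) (Fin n) ℝ) - hessian f x).mulVec v.ofLp
        = M * ‖v‖ ^ 2 - fderiv ℝ (fderiv ℝ f) x v v := by
    intro v
    rw [Matrix.sub_mulVec, dotProduct_sub, star_trivial, dotProduct_hessian_mulVec,
      Matrix.smul_mulVec, Matrix.one_mulVec, dotProduct_smul, EuclideanSpace.norm_sq_eq]
    simp [dotProduct, sq]
  rw [Matrix.le_iff]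
  constructor
  · intro h v
    have := h.dotProduct_mulVec_nonneg v.ofLp
    rw [key] at this
    linarith
  · intro h
    refine Matrix.PosSemidef.of_dotProduct_mulVec_nonneg ?_ fun v => ?_
    · refine Matrix.IsHermitian.sub ?_ (isHermitian_hessian hf x)
      simp [Matrix.IsHermitian]
    · have := key (WithLp.toLp 2 v)
      simp only at this
      rw [this]
      linarith [h (WithLp.toLp 2 v)]

lemma forall_le_hessian_iff (hf : ContDiff ℝ 2 f) {M : ℝ} :
    (∀ x, (-M) • 1 ≤ hessian f x) ↔
      ∀ x v, -(M * ‖v‖ ^ 2) ≤ f (x + v) + f (x - v) - 2 * f x := by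
  have hneg : ∀ x, hessian (-f) x = -hessian f x := by
    intro x
    ext i j
    simp [hessian, iteratedFDeriv_neg_apply]
  have h := forall_hessian_le_iff hf.neg (M := M)
  have e1 : (∀ x, (-M) • 1 ≤ hessian f x) ↔ ∀ x, hessian (fun x => -f x) x ≤ M • 1 := by
    refine forall_congr' fun x => ?_
    rw [show (fun x => -f x) = -f from rfl, hneg, neg_smul]
    exact neg_le
  rw [e1, h]
  refine forall_congr' fun x => forall_congr' fun v => ?_
  constructor <;> intro h <;> linarith

end Hessian

/-! ### Smoothing by the heat kernel -/

/-- The density of the centered Gaussian law on `ℝⁿ` with covariance matrix `s • 1`. -/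
noncomputable def heatKernel (n : ℕ) (s : ℝ) (x : EuclideanSpace ℝ (Fin n)) : ℝ :=
  (2 * Real.pi * s) ^ (-(n : ℝ) / 2) * Real.exp (-(2 * s)⁻¹ * ‖x‖ ^ 2)

/-- The real inner product, typed as a linear rather than a conjugate-linear map. -/
noncomputable def innerBilin (n : ℕ) :
    EuclideanSpace ℝ (Fin n) →L[ℝ] EuclideanSpace ℝ (Fin n) →L[ℝ] ℝ :=
  innerSL ℝ

section Kernel

variable {n : ℕ} {s : ℝ}

lemma heatKernel_pos (hs : 0 < s) (x : EuclideanSpace ℝ (Fin n)) : 0 < heatKernel n s x := by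
  unfold heatKernel; positivity

lemma contDiff_heatKernel : ContDiff ℝ 2 (heatKernel n s) := by
  unfold heatKernel
  exact contDiff_const.mul (Real.contDiff_exp.comp (contDiff_const.mul (contDiff_norm_sq ℝ)))

lemma measurable_heatKernel : Measurable (heatKernel n s) :=
  contDiff_heatKernel.continuous.measurable

lemma hasFDerivAt_heatKernel (x : EuclideanSpace ℝ (Fin n)) :
    HasFDerivAt (heatKernel n s) (heatKernel n s x • (-s⁻¹ • innerSL ℝ x)) x := by
  have h1 : HasFDerivAt (fun x : EuclideanSpace ℝ (Fin n) => ‖x‖ ^ 2) (2 • innerSL ℝ x) x :=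
    (hasStrictFDerivAt_norm_sq x).hasFDerivAt
  have h2 := ((h1.const_mul (-(2 * s)⁻¹)).exp).const_mul ((2 * Real.pi * s) ^ (-(n : ℝ) / 2))
  refine h2.congr_fderiv ?_
  ext v
  simp only [heatKernel, smul_apply, smul_eq_mul, nsmul_eq_mul, mul_inv]
  ring_nf

lemma fderiv_heatKernel :
    fderiv ℝ (heatKernel n s) = fun x => heatKernel n s x • (-s⁻¹ • innerSL ℝ x) :=
  funext fun x => (hasFDerivAt_heatKernel x).fderiv

lemma hasFDerivAt_fderiv_heatKernel (x : EuclideanSpace ℝ (Fin n)) :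
    HasFDerivAt (fderiv ℝ (heatKernel n s))
      (heatKernel n s x • (-s⁻¹ • innerBilin n) +
        (heatKernel n s x • (-s⁻¹ • innerSL ℝ x)).smulRight (-s⁻¹ • innerSL ℝ x)) x := by
  rw [fderiv_heatKernel]
  have h2 : HasFDerivAt (fun x : EuclideanSpace ℝ (Fin n) => -s⁻¹ • innerSL ℝ x)
      (-s⁻¹ • innerBilin n) x := (-s⁻¹ • innerBilin n).hasFDerivAt
  exact (hasFDerivAt_heatKernel x).smul h2

/-- The kernel decays fast enough to absorb the quadratic growth of the factors that appear in its
first two derivatives. -/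
lemma exists_heatKernel_bound (hs : 0 < s) :
    ∃ C, ∀ x : EuclideanSpace ℝ (Fin n), heatKernel n s x * (1 + ‖x‖ ^ 2) ≤ C := by
  refine ⟨(2 * Real.pi * s) ^ (-(n : ℝ) / 2) * (1 + 2 * s), fun x => ?_⟩
  unfold heatKernel
  rw [mul_assoc]
  gcongr
  set u := (2 * s)⁻¹ * ‖x‖ ^ 2 with hu
  have hu0 : 0 ≤ u := by positivity
  have hx : ‖x‖ ^ 2 = 2 * s * u := by rw [hu]; field_simp
  have h1 : u * Real.exp (-u) ≤ 1 := by
    rw [Real.exp_neg, ← div_eq_mul_inv, div_le_one (Real.exp_pos _)]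
    linarith [Real.add_one_le_exp u]
  have h2 : Real.exp (-u) ≤ 1 := by simpa using hu0
  rw [hx, show -(2 * s)⁻¹ * (2 * s * u) = -u by field_simp]
  nlinarith

lemma exists_norm_heatKernel_le (hs : 0 < s) :
    ∃ C, ∀ x : EuclideanSpace ℝ (Fin n), ‖heatKernel n s x‖ ≤ C := by
  obtain ⟨C, hC⟩ := exists_heatKernel_bound (n := n) hs
  refine ⟨C, fun x => le_trans ?_ (hC x)⟩
  rw [Real.norm_of_nonneg (heatKernel_pos hs x).le]
  nlinarith [heatKernel_pos hs x, mul_nonneg (heatKernel_pos hs x).le (sq_nonneg ‖x‖)]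

lemma exists_norm_fderiv_heatKernel_le (hs : 0 < s) :
    ∃ C, ∀ x : EuclideanSpace ℝ (Fin n), ‖fderiv ℝ (heatKernel n s) x‖ ≤ C := by
  obtain ⟨C, hC⟩ := exists_heatKernel_bound (n := n) hs
  refine ⟨s⁻¹ * C, fun x => ?_⟩
  have hk := heatKernel_pos hs x
  rw [fderiv_heatKernel, norm_smul, norm_smul, Real.norm_of_nonneg hk.le, norm_neg, norm_inv,
    Real.norm_of_nonneg hs.le, innerSL_apply_norm]
  have : heatKernel n s x * ‖x‖ ≤ C := by
    refine le_trans ?_ (hC x)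
    gcongr
    nlinarith [sq_nonneg (‖x‖ - 1)]
  calc heatKernel n s x * (s⁻¹ * ‖x‖) = s⁻¹ * (heatKernel n s x * ‖x‖) := by ring
    _ ≤ s⁻¹ * C := by gcongr

lemma exists_norm_fderiv_fderiv_heatKernel_le (hs : 0 < s) :
    ∃ C, ∀ x : EuclideanSpace ℝ (Fin n), ‖fderiv ℝ (fderiv ℝ (heatKernel n s)) x‖ ≤ C := by
  obtain ⟨C, hC⟩ := exists_heatKernel_bound (n := n) hs
  refine ⟨s⁻¹ * (C * ‖innerBilin n‖) + s⁻¹ * s⁻¹ * C, fun x => ?_⟩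
  have hk := heatKernel_pos hs x
  have hk1 : heatKernel n s x ≤ C := by
    refine le_trans ?_ (hC x)
    nlinarith [mul_nonneg hk.le (sq_nonneg ‖x‖)]
  have hk2 : heatKernel n s x * ‖x‖ ^ 2 ≤ C := by
    refine le_trans ?_ (hC x)
    gcongr
    linarith
  rw [(hasFDerivAt_fderiv_heatKernel x).fderiv]
  refine (ContinuousLinearMap.opNorm_add_le _ _).trans (add_le_add ?_ ?_)
  · rw [norm_smul, norm_smul, Real.norm_of_nonneg hk.le, norm_neg, norm_inv,
      Real.norm_of_nonneg hs.le, mul_left_comm]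
    gcongr
  · rw [ContinuousLinearMap.norm_smulRight_apply, norm_smul, norm_smul, Real.norm_of_nonneg hk.le,
      norm_neg, norm_inv, Real.norm_of_nonneg hs.le, innerSL_apply_norm]
    calc _ = s⁻¹ * s⁻¹ * (heatKernel n s x * ‖x‖ ^ 2) := by ring
      _ ≤ _ := by gcongr

end Kernel

section Smoothing

variable {E G : Type*} [NormedAddCommGroup E] [NormedSpace ℝ E] [FiniteDimensional ℝ E]
  [MeasurableSpace E] [BorelSpace E] [NormedAddCommGroup G] [NormedSpace ℝ G]
  [FiniteDimensional ℝ G]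

omit [FiniteDimensional ℝ E] in
lemma integrable_comp_sub_smul {K : E → G} (hK : Continuous K) {C : ℝ} (hC : ∀ x, ‖K x‖ ≤ C)
    (μ : Measure E) [IsFiniteMeasure μ] (a : ℝ) (x : E) :
    Integrable (fun y => K (x - a • y)) μ :=
  Integrable.of_bound (by
    have : Continuous fun y => K (x - a • y) := by fun_prop
    exact this.aestronglyMeasurable) C (.of_forall fun y => hC _)

omit [FiniteDimensional ℝ E] in
lemma continuous_integral_comp_sub_smul {K : E → G} (hK : Continuous K) {C : ℝ}
    (hC : ∀ x, ‖K x‖ ≤ C) (μ : Measure E) [IsFiniteMeasure μ] (a : ℝ) :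
    Continuous fun x => ∫ y, K (x - a • y) ∂μ :=
  continuous_of_dominated (bound := fun _ => C)
    (fun x => (integrable_comp_sub_smul hK hC μ a x).aestronglyMeasurable)
    (fun x => .of_forall fun y => hC _) (integrable_const _)
    (.of_forall fun y => by fun_prop)

lemma hasFDerivAt_integral_comp_sub_smul {K : E → G} (hK : ContDiff ℝ 1 K) {C C' : ℝ}
    (hC : ∀ x, ‖K x‖ ≤ C) (hC' : ∀ x, ‖fderiv ℝ K x‖ ≤ C') (μ : Measure E) [IsFiniteMeasure μ]
    (a : ℝ) (x : E) :
    HasFDerivAt (fun x => ∫ y, K (x - a • y) ∂μ) (∫ y, fderiv ℝ K (x - a • y) ∂μ) x := by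
  refine hasFDerivAt_integral_of_dominated_of_fderiv_le (s := Set.univ) (bound := fun _ => C')
    (F' := fun x y => fderiv ℝ K (x - a • y)) Filter.univ_mem
    (.of_forall fun x => (integrable_comp_sub_smul hK.continuous hC μ a x).aestronglyMeasurable)
    (integrable_comp_sub_smul hK.continuous hC μ a x)
    (integrable_comp_sub_smul (hK.continuous_fderiv (by norm_num)) hC' μ a x).aestronglyMeasurable
    (.of_forall fun y x _ => hC' _) (integrable_const _) (.of_forall fun y x _ => ?_)
  exact ((hK.differentiable (by norm_num) (x - a • y)).hasFDerivAt).comp x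
    ((hasFDerivAt_id x).sub_const (a • y)) |>.congr_fderiv (by ext; simp)

/-- Averaging translates of a `C²` function with bounded derivatives over a finite measure, which
need have no moments, gives a `C²` function. -/
lemma contDiff_two_integral_comp_sub_smul {K : E → G} (hK : ContDiff ℝ 2 K) {C₀ C₁ C₂ : ℝ}
    (h0 : ∀ x, ‖K x‖ ≤ C₀) (h1 : ∀ x, ‖fderiv ℝ K x‖ ≤ C₁)
    (h2 : ∀ x, ‖fderiv ℝ (fderiv ℝ K) x‖ ≤ C₂) (μ : Measure E) [IsFiniteMeasure μ] (a : ℝ) :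
    ContDiff ℝ 2 fun x => ∫ y, K (x - a • y) ∂μ := by
  have hK1 : ContDiff ℝ 1 (fderiv ℝ K) := hK.fderiv_right (by norm_num)
  have d1 := hasFDerivAt_integral_comp_sub_smul (hK.of_le (by norm_num)) h0 h1 μ a
  have d2 := hasFDerivAt_integral_comp_sub_smul hK1 h1 h2 μ a
  rw [show (2 : WithTop ℕ∞) = 1 + 1 by norm_num, contDiff_succ_iff_fderiv]
  refine ⟨fun x => (d1 x).differentiableAt, by simp, ?_⟩
  rw [funext fun x => (d1 x).fderiv, contDiff_one_iff_fderiv]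
  refine ⟨fun x => (d2 x).differentiableAt, ?_⟩
  rw [funext fun x => (d2 x).fderiv]
  exact continuous_integral_comp_sub_smul (hK1.continuous_fderiv (by norm_num)) h2 μ a

end Smoothing

/-- The density at `x` of the law of `a • Y + √s • Z`, when `Y` has law `μ` and `Z` is an
independent standard Gaussian vector. -/
noncomputable def smoothedDensity {n : ℕ} (μ : Measure (EuclideanSpace ℝ (Fin n))) (a s : ℝ)
    (x : EuclideanSpace ℝ (Fin n)) : ℝ :=
  ∫ y, heatKernel n s (x - a • y) ∂μ

section SmoothedDensity

variable {n : ℕ} {μ : Measure (EuclideanSpace ℝ (Fin n))} [IsProbabilityMeasure μ] {a s : ℝ}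

lemma integrable_heatKernel_comp (hs : 0 < s) (x : EuclideanSpace ℝ (Fin n)) :
    Integrable (fun y => heatKernel n s (x - a • y)) μ := by
  obtain ⟨C, hC⟩ := exists_norm_heatKernel_le (n := n) hs
  exact integrable_comp_sub_smul contDiff_heatKernel.continuous hC μ a x

lemma smoothedDensity_pos (hs : 0 < s) (x : EuclideanSpace ℝ (Fin n)) :
    0 < smoothedDensity μ a s x := by
  refine (integral_pos_iff_support_of_nonneg (fun y => (heatKernel_pos hs _).le)
    (integrable_heatKernel_comp hs x)).2 ?_
  have : (Function.support fun y => heatKernel n s (x - a • y)) = Set.univ :=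
    Set.eq_univ_of_forall fun y => (heatKernel_pos hs _).ne'
  simp [this]

lemma contDiff_smoothedDensity (hs : 0 < s) : ContDiff ℝ 2 (smoothedDensity μ a s) := by
  obtain ⟨C₀, h0⟩ := exists_norm_heatKernel_le (n := n) hs
  obtain ⟨C₁, h1⟩ := exists_norm_fderiv_heatKernel_le (n := n) hs
  obtain ⟨C₂, h2⟩ := exists_norm_fderiv_fderiv_heatKernel_le (n := n) hs
  exact contDiff_two_integral_comp_sub_smul contDiff_heatKernel h0 h1 h2 μ a

lemma contDiff_scorePotential {r : EuclideanSpace ℝ (Fin n) → ℝ} (hr : ContDiff ℝ 2 r)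
    (hpos : ∀ x, 0 < r x) : ContDiff ℝ 2 (scorePotential r) := by
  unfold scorePotential
  exact (hr.log fun x => (hpos x).ne').neg.sub ((contDiff_norm_sq ℝ).div_const 2)

lemma ofReal_smoothedDensity (hs : 0 < s) (x : EuclideanSpace ℝ (Fin n)) :
    ENNReal.ofReal (smoothedDensity μ a s x) =
      ∫⁻ y, ENNReal.ofReal (heatKernel n s (x - a • y)) ∂μ :=
  ofReal_integral_eq_lintegral_ofReal (integrable_heatKernel_comp hs x)
    (.of_forall fun _ => (heatKernel_pos hs _).le)

/-- The Gaussian law on `ℝⁿ` with density `heatKernel n s`. -/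
noncomputable def heatMeasure (n : ℕ) (s : ℝ) : Measure (EuclideanSpace ℝ (Fin n)) :=
  volume.withDensity fun x => ENNReal.ofReal (heatKernel n s x)

lemma charFun_heatMeasure (hs : 0 < s) (u : EuclideanSpace ℝ (Fin n)) :
    charFun (heatMeasure n s) u = Complex.exp (-(s * ‖u‖ ^ 2 / 2 : ℝ)) := by
  rw [charFun_apply, heatMeasure, integral_withDensity_eq_integral_toReal_smul
    (by have := measurable_heatKernel (n := n) (s := s); fun_prop) (by simp)]
  have hb : 0 < (((2 * s)⁻¹ : ℝ) : ℂ).re := by rw [Complex.ofReal_re]; positivity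
  have key := GaussianFourier.integral_cexp_neg_mul_sq_norm_add hb Complex.I u
  have hπ : (0 : ℝ) < 2 * Real.pi * s := by positivity
  calc _ = ∫ v : EuclideanSpace ℝ (Fin n), (((2 * Real.pi * s) ^ (-(n : ℝ) / 2) : ℝ) : ℂ) *
        Complex.exp (-(((2 * s)⁻¹ : ℝ) : ℂ) * ‖v‖ ^ 2 + Complex.I * (inner ℝ u v : ℝ)) := by
        refine integral_congr_ae (.of_forall fun v => ?_)
        simp only
        rw [ENNReal.toReal_ofReal (heatKernel_pos hs v).le, heatKernel, Complex.real_smul,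
          Complex.exp_add, real_inner_comm u v]
        push_cast
        ring_nf
    _ = _ := by
        rw [integral_const_mul, key, ← mul_assoc]
        have e1 : (((2 * Real.pi * s) ^ (-(n : ℝ) / 2) : ℝ) : ℂ) *
            ((Real.pi : ℂ) / (((2 * s)⁻¹ : ℝ) : ℂ)) ^
              ((Module.finrank ℝ (EuclideanSpace ℝ (Fin n)) : ℂ) / 2) = 1 := by
          have : ((Real.pi : ℂ) / (((2 * s)⁻¹ : ℝ) : ℂ)) = ((2 * Real.pi * s : ℝ) : ℂ) := by
            push_cast; field_simp
          rw [this, finrank_euclideanSpace_fin,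
            show ((n : ℂ) / 2) = (((n : ℝ) / 2 : ℝ) : ℂ) by push_cast; rfl,
            ← Complex.ofReal_cpow hπ.le, ← Complex.ofReal_mul, ← Real.rpow_add hπ]
          simp [neg_div]
        rw [e1, one_mul, Complex.I_sq]
        congr 1
        have : (s : ℂ) ≠ 0 := by exact_mod_cast hs.ne'
        push_cast
        field_simp
        ring

/-- The total mass is the value of the characteristic function at the origin. -/
lemma isProbabilityMeasure_heatMeasure (hs : 0 < s) : IsProbabilityMeasure (heatMeasure n s) := by
  have h := charFun_heatMeasure (n := n) hs 0
  rw [charFun_zero] at h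
  have h1 : (heatMeasure n s).real Set.univ = 1 := by
    rw [← Complex.ofReal_inj, h]; simp
  exact ⟨(ENNReal.toReal_eq_one_iff _).1 h1⟩

/-- `smoothedDensity μ a s` is the density of the convolution of the law of `a • Y` with the
Gaussian law of covariance `s • 1`. -/
lemma withDensity_smoothedDensity (hs : 0 < s) :
    (volume.withDensity fun x => ENNReal.ofReal (smoothedDensity μ a s x)) =
      (μ.map fun y => a • y).conv (heatMeasure n s) := by
  have hk := measurable_heatKernel (n := n) (s := s)
  have hF : Measurable (smoothedDensity μ a s) := (contDiff_smoothedDensity hs).continuous.measurable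
  refine Measure.ext_of_lintegral _ fun φ hφ => ?_
  have : SFinite (heatMeasure n s) := by unfold heatMeasure; infer_instance
  rw [Measure.lintegral_conv hφ, lintegral_map (by fun_prop) (by fun_prop),
    lintegral_withDensity_eq_lintegral_mul _ (by fun_prop) hφ]
  calc _ = ∫⁻ x, ∫⁻ y, ENNReal.ofReal (heatKernel n s (x - a • y)) * φ x ∂μ := by
        refine lintegral_congr fun x => ?_
        rw [Pi.mul_apply, ofReal_smoothedDensity hs, lintegral_mul_const _ (by fun_prop)]
    _ = ∫⁻ y, ∫⁻ x, ENNReal.ofReal (heatKernel n s (x - a • y)) * φ x ∂volume ∂μ :=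
        lintegral_lintegral_swap (by fun_prop)
    _ = _ := by
        refine lintegral_congr fun y => ?_
        rw [heatMeasure, lintegral_withDensity_eq_lintegral_mul _ (by fun_prop) (by fun_prop),
          ← lintegral_add_left_eq_self _ (a • y)]
        simp

end SmoothedDensity

/-! ### Second differences of the smoothed potential -/

/-- The Mehler-type transform `x ↦ E[exp (-g (a • x + √s • Z))]` for a standard Gaussian vector
`Z`, written as an integral against the Gaussian density centered at `a • x`. -/
noncomputable def gaussianTransform {n : ℕ} (g : EuclideanSpace ℝ (Fin n) → ℝ) (a s : ℝ)
    (x : EuclideanSpace ℝ (Fin n)) : ℝ≥0∞ :=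
  ∫⁻ y, ENNReal.ofReal (Real.exp (-g y) * heatKernel n s (y - a • x))

/-- The Cauchy–Schwarz inequality, for `u ≤ √f * √g`. -/
lemma lintegral_sq_le_mul {α : Type*} [MeasurableSpace α] {μ : Measure α} {u f g : α → ℝ≥0∞}
    (hf : Measurable f) (hg : Measurable g) (H : ∀ x, u x ^ 2 ≤ f x * g x) :
    (∫⁻ x, u x ∂μ) ^ 2 ≤ (∫⁻ x, f x ∂μ) * ∫⁻ x, g x ∂μ := by
  have hr : ∀ z : ℝ≥0∞, (z ^ (1 / 2 : ℝ)) ^ 2 = z := fun z => by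
    rw [← ENNReal.rpow_natCast, ← ENNReal.rpow_mul]; norm_num
  have h1 : ∀ x, u x ≤ f x ^ (1 / 2 : ℝ) * g x ^ (1 / 2 : ℝ) := fun x => by
    refine (ENNReal.pow_le_pow_left_iff two_ne_zero).1 ?_
    rw [mul_pow, hr, hr]
    exact H x
  calc (∫⁻ x, u x ∂μ) ^ 2 ≤ (∫⁻ x, f x ^ (1 / 2 : ℝ) * g x ^ (1 / 2 : ℝ) ∂μ) ^ 2 := by
        gcongr with x; exact h1 x
    _ ≤ ((∫⁻ x, f x ∂μ) ^ (1 / 2 : ℝ) * (∫⁻ x, g x ∂μ) ^ (1 / 2 : ℝ)) ^ 2 := by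
        gcongr
        exact ENNReal.lintegral_mul_norm_pow_le hf.aemeasurable hg.aemeasurable (by norm_num)
          (by norm_num) (by norm_num)
    _ = _ := by rw [mul_pow, hr, hr]

section Transform

variable {n : ℕ} {g : EuclideanSpace ℝ (Fin n) → ℝ} {a s : ℝ}

lemma gaussianTransform_eq_lintegral_add (x : EuclideanSpace ℝ (Fin n)) :
    gaussianTransform g a s x =
      ∫⁻ z, ENNReal.ofReal (Real.exp (-g (a • x + z)) * heatKernel n s z) := by
  rw [gaussianTransform, ← lintegral_add_left_eq_self _ (a • x)]
  simp

/-- Translated copies of `g` are averaged against the same Gaussian, so an upper bound on second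
differences passes to the transform by the Cauchy–Schwarz inequality. -/
lemma gaussianTransform_sq_le (hg : Measurable g) {M : ℝ} (hs : 0 < s)
    (hM : ∀ x v, g (x + v) + g (x - v) - 2 * g x ≤ M * ‖v‖ ^ 2)
    (x h : EuclideanSpace ℝ (Fin n)) :
    gaussianTransform g a s x ^ 2 ≤ ENNReal.ofReal (Real.exp (a ^ 2 * M * ‖h‖ ^ 2)) *
      (gaussianTransform g a s (x + h) * gaussianTransform g a s (x - h)) := by
  have hk := measurable_heatKernel (n := n) (s := s)
  rw [gaussianTransform_eq_lintegral_add x, gaussianTransform_eq_lintegral_add (x + h),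
    gaussianTransform_eq_lintegral_add (x - h), ← mul_assoc,
    ← lintegral_const_mul (ENNReal.ofReal (Real.exp (a ^ 2 * M * ‖h‖ ^ 2))) (by fun_prop)]
  refine lintegral_sq_le_mul ?_ ?_ fun z => ?_
  · fun_prop
  · fun_prop
  have hz := (heatKernel_pos hs z).le
  rw [← ENNReal.ofReal_pow (by positivity), ← ENNReal.ofReal_mul (by positivity),
    ← ENNReal.ofReal_mul (by positivity)]
  refine ENNReal.ofReal_le_ofReal ?_
  have h1 := hM (a • x + z) (a • h)
  rw [norm_smul, mul_pow, Real.norm_eq_abs, sq_abs,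
    show a • x + z + a • h = a • (x + h) + z by module,
    show a • x + z - a • h = a • (x - h) + z by module] at h1
  calc _ = Real.exp (-(2 * g (a • x + z))) * heatKernel n s z ^ 2 := by
        rw [mul_pow, ← Real.exp_nat_mul]; congr 2; push_cast; ring
    _ ≤ Real.exp (a ^ 2 * M * ‖h‖ ^ 2 + -g (a • (x + h) + z) + -g (a • (x - h) + z)) *
          heatKernel n s z ^ 2 := by
        gcongr; linarith
    _ = _ := by rw [Real.exp_add, Real.exp_add]; ring

/-- A lower bound on second differences passes to the transform by the Prékopa–Leindler
inequality: the Gaussian kernel supplies joint convexity as long as `M * s < 1`, and minimizing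
the resulting quadratic form over the integration variable gives the constant. -/
lemma gaussianTransform_mul_le (hg : Measurable g) {M : ℝ} (hs : 0 < s) (hMs : M * s < 1)
    (hM : ∀ x v, -(M * ‖v‖ ^ 2) ≤ g (x + v) + g (x - v) - 2 * g x)
    (x h : EuclideanSpace ℝ (Fin n)) :
    gaussianTransform g a s (x + h) * gaussianTransform g a s (x - h) ≤
      ENNReal.ofReal (Real.exp (M * a ^ 2 / (1 - M * s) * ‖h‖ ^ 2)) *
        gaussianTransform g a s x ^ 2 := by
  have hk := measurable_heatKernel (n := n) (s := s)
  have hc : ENNReal.ofReal (Real.exp (M * a ^ 2 / (1 - M * s) * ‖h‖ ^ 2)) =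
      ENNReal.ofReal (Real.exp (M * a ^ 2 / (1 - M * s) * ‖h‖ ^ 2 / 2)) ^ 2 := by
    rw [← ENNReal.ofReal_pow (Real.exp_pos _).le, ← Real.exp_nat_mul]
    congr 2; push_cast; ring
  rw [hc, ← mul_pow, gaussianTransform, gaussianTransform, gaussianTransform,
    ← lintegral_const_mul (ENNReal.ofReal (Real.exp (M * a ^ 2 / (1 - M * s) * ‖h‖ ^ 2 / 2)))
      (by fun_prop)]
  refine prekopaLeindler ?_ ?_ ?_ fun y₁ y₂ => ?_
  · fun_prop
  · fun_prop
  · fun_prop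
  obtain ⟨m, d, rfl, rfl⟩ : ∃ m d : EuclideanSpace ℝ (Fin n), y₁ = m + d ∧ y₂ = m - d :=
    ⟨(1 / 2 : ℝ) • (y₁ + y₂), (1 / 2 : ℝ) • (y₁ - y₂), by module, by module⟩
  rw [show (1 / 2 : ℝ) • (m + d + (m - d)) = m by module]
  have p1 := (heatKernel_pos hs (m + d - a • (x + h))).le
  have p2 := (heatKernel_pos hs (m - d - a • (x - h))).le
  have p3 := (heatKernel_pos hs (m - a • x)).le
  rw [← ENNReal.ofReal_mul (by positivity), ← ENNReal.ofReal_mul (by positivity),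
    ← ENNReal.ofReal_pow (by positivity)]
  refine ENNReal.ofReal_le_ofReal ?_
  have hpar : ‖m + d - a • (x + h)‖ ^ 2 + ‖m - d - a • (x - h)‖ ^ 2 =
      2 * ‖m - a • x‖ ^ 2 + 2 * ‖d - a • h‖ ^ 2 := by
    have := parallelogram_law_with_norm ℝ (m - a • x) (d - a • h)
    rw [show m + d - a • (x + h) = m - a • x + (d - a • h) by module,
      show m - d - a • (x - h) = m - a • x - (d - a • h) by module]
    linarith
  have hpos : 0 < 1 - M * s := by linarith
  -- the defect of the inequality is a multiple of `‖d - β • h‖ ^ 2`, with `β = a / (1 - M * s)`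
  have hquad : M * ‖d‖ ^ 2 - s⁻¹ * ‖d - a • h‖ ^ 2 ≤ M * a ^ 2 / (1 - M * s) * ‖h‖ ^ 2 := by
    have h0 : 0 ≤ (1 - M * s) / s * ‖d - (a / (1 - M * s)) • h‖ ^ 2 := by positivity
    rw [norm_sub_sq_real, inner_smul_right, norm_smul, mul_pow, Real.norm_eq_abs, sq_abs] at h0 ⊢
    have e : (1 - M * s) / s * (‖d‖ ^ 2 - 2 * (a / (1 - M * s) * inner ℝ d h) +
        (a / (1 - M * s)) ^ 2 * ‖h‖ ^ 2) = M * a ^ 2 / (1 - M * s) * ‖h‖ ^ 2 -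
        (M * ‖d‖ ^ 2 - s⁻¹ * (‖d‖ ^ 2 - 2 * (a * inner ℝ d h) + a ^ 2 * ‖h‖ ^ 2)) := by
      field_simp
      ring
    linarith
  have hgm := hM m d
  have hexp : -g (m + d) + -(2 * s)⁻¹ * ‖m + d - a • (x + h)‖ ^ 2 +
      (-g (m - d) + -(2 * s)⁻¹ * ‖m - d - a • (x - h)‖ ^ 2) ≤
      2 * (M * a ^ 2 / (1 - M * s) * ‖h‖ ^ 2 / 2 + (-g m + -(2 * s)⁻¹ * ‖m - a • x‖ ^ 2)) := by
    have : -(2 * s)⁻¹ * ‖m + d - a • (x + h)‖ ^ 2 + -(2 * s)⁻¹ * ‖m - d - a • (x - h)‖ ^ 2 =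
        2 * (-(2 * s)⁻¹ * ‖m - a • x‖ ^ 2) - s⁻¹ * ‖d - a • h‖ ^ 2 := by
      rw [← mul_add, hpar, mul_inv]; ring
    linarith
  unfold heatKernel
  set C := (2 * Real.pi * s) ^ (-(n : ℝ) / 2)
  calc _ = C ^ 2 * Real.exp (-g (m + d) + -(2 * s)⁻¹ * ‖m + d - a • (x + h)‖ ^ 2 +
        (-g (m - d) + -(2 * s)⁻¹ * ‖m - d - a • (x - h)‖ ^ 2)) := by
        simp only [Real.exp_add]; ring
    _ ≤ C ^ 2 * Real.exp (2 * (M * a ^ 2 / (1 - M * s) * ‖h‖ ^ 2 / 2 +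
        (-g m + -(2 * s)⁻¹ * ‖m - a • x‖ ^ 2))) := by gcongr
    _ = _ := by
        rw [show ∀ z : ℝ, Real.exp (2 * z) = Real.exp z ^ 2 from fun z => by
          rw [← Real.exp_nat_mul]; norm_num, Real.exp_add, Real.exp_add]
        ring

end Transform

section Potential

variable {n : ℕ} {p₀ : EuclideanSpace ℝ (Fin n) → ℝ} {a s : ℝ}

lemma exp_neg_scorePotential {x : EuclideanSpace ℝ (Fin n)} (hpos : 0 < p₀ x) :
    Real.exp (-scorePotential p₀ x) = p₀ x * Real.exp (‖x‖ ^ 2 / 2) := by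
  rw [scorePotential, neg_sub, sub_neg_eq_add, Real.exp_add, Real.exp_log hpos, mul_comm]

lemma continuous_of_continuous_scorePotential (hpos : ∀ x, 0 < p₀ x)
    (hg : Continuous (scorePotential p₀)) : Continuous p₀ := by
  have : p₀ = fun x => Real.exp (-scorePotential p₀ x) * Real.exp (-(‖x‖ ^ 2 / 2)) := by
    ext x
    rw [exp_neg_scorePotential (hpos x), mul_assoc, ← Real.exp_add]
    simp
  rw [this]
  fun_prop

/-- When `a ^ 2 + s = 1`, the standard Gaussian law is invariant under `y ↦ a • y + √s • Z`, so
the Gaussian factor `exp (-‖x‖ ^ 2 / 2)` splits off. -/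
lemma ofReal_exp_neg_scorePotential_smoothedDensity (hp : Continuous p₀) (hpos : ∀ x, 0 < p₀ x)
    [IsProbabilityMeasure (volume.withDensity fun x => ENNReal.ofReal (p₀ x))]
    (hs : 0 < s) (has : a ^ 2 + s = 1) (x : EuclideanSpace ℝ (Fin n)) :
    ENNReal.ofReal (Real.exp (-scorePotential (smoothedDensity
        (volume.withDensity fun x => ENNReal.ofReal (p₀ x)) a s) x)) =
      gaussianTransform (scorePotential p₀) a s x := by
  have hk := measurable_heatKernel (n := n) (s := s)
  have hpm := hp.measurable
  rw [exp_neg_scorePotential (smoothedDensity_pos hs x),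
    ENNReal.ofReal_mul (smoothedDensity_pos hs x).le, ofReal_smoothedDensity hs,
    lintegral_withDensity_eq_lintegral_mul _ (by fun_prop) (by fun_prop),
    ← lintegral_mul_const _ (by fun_prop), gaussianTransform]
  refine lintegral_congr fun y => ?_
  have h1 := (heatKernel_pos hs (x - a • y)).le
  rw [Pi.mul_apply, ← ENNReal.ofReal_mul (hpos y).le, ← ENNReal.ofReal_mul (by
    have := hpos y; positivity), exp_neg_scorePotential (hpos y)]
  congr 1
  have key : -(2 * s)⁻¹ * ‖x - a • y‖ ^ 2 + ‖x‖ ^ 2 / 2 =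
      ‖y‖ ^ 2 / 2 + -(2 * s)⁻¹ * ‖y - a • x‖ ^ 2 := by
    rw [norm_sub_sq_real, norm_sub_sq_real, inner_smul_right, inner_smul_right, norm_smul,
      norm_smul, mul_pow, mul_pow, Real.norm_eq_abs, sq_abs, real_inner_comm,
      show a ^ 2 = 1 - s by linarith]
    field_simp
    ring
  unfold heatKernel
  calc _ = p₀ y * (2 * Real.pi * s) ^ (-(n : ℝ) / 2) *
        Real.exp (-(2 * s)⁻¹ * ‖x - a • y‖ ^ 2 + ‖x‖ ^ 2 / 2) := by rw [Real.exp_add]; ring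
    _ = _ := by rw [key, Real.exp_add]; ring

variable [IsProbabilityMeasure (volume.withDensity fun x => ENNReal.ofReal (p₀ x))]

lemma scorePotential_smoothedDensity_second_difference_le (hpos : ∀ x, 0 < p₀ x)
    (hg : Continuous (scorePotential p₀)) (hs : 0 < s) (has : a ^ 2 + s = 1) {M : ℝ}
    (hM : ∀ x v, scorePotential p₀ (x + v) + scorePotential p₀ (x - v) - 2 * scorePotential p₀ x
      ≤ M * ‖v‖ ^ 2) {q : EuclideanSpace ℝ (Fin n) → ℝ}
    (hq : q = scorePotential (smoothedDensity
      (volume.withDensity fun x => ENNReal.ofReal (p₀ x)) a s))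
    (x h : EuclideanSpace ℝ (Fin n)) :
    q (x + h) + q (x - h) - 2 * q x ≤ a ^ 2 * M * ‖h‖ ^ 2 := by
  have key := gaussianTransform_sq_le (a := a) hg.measurable hs hM x h
  have hp := continuous_of_continuous_scorePotential hpos hg
  simp only [← ofReal_exp_neg_scorePotential_smoothedDensity hp hpos hs has, ← hq] at key
  rw [← ENNReal.ofReal_pow (Real.exp_pos _).le, ← ENNReal.ofReal_mul (Real.exp_pos _).le,
    ← ENNReal.ofReal_mul (Real.exp_pos _).le, ← Real.exp_add, ← Real.exp_add, ← Real.exp_nat_mul,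
    ENNReal.ofReal_le_ofReal_iff (Real.exp_pos _).le, Real.exp_le_exp] at key
  push_cast at key
  linarith

lemma le_scorePotential_smoothedDensity_second_difference (hpos : ∀ x, 0 < p₀ x)
    (hg : Continuous (scorePotential p₀)) (hs : 0 < s) (has : a ^ 2 + s = 1) {M : ℝ}
    (hMs : M * s < 1)
    (hM : ∀ x v, -(M * ‖v‖ ^ 2) ≤
      scorePotential p₀ (x + v) + scorePotential p₀ (x - v) - 2 * scorePotential p₀ x)
    {q : EuclideanSpace ℝ (Fin n) → ℝ}
    (hq : q = scorePotential (smoothedDensity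
      (volume.withDensity fun x => ENNReal.ofReal (p₀ x)) a s))
    (x h : EuclideanSpace ℝ (Fin n)) :
    -(M * a ^ 2 / (1 - M * s) * ‖h‖ ^ 2) ≤ q (x + h) + q (x - h) - 2 * q x := by
  have key := gaussianTransform_mul_le (a := a) hg.measurable hs hMs hM x h
  have hp := continuous_of_continuous_scorePotential hpos hg
  simp only [← ofReal_exp_neg_scorePotential_smoothedDensity hp hpos hs has, ← hq] at key
  rw [← ENNReal.ofReal_pow (Real.exp_pos _).le, ← ENNReal.ofReal_mul (Real.exp_pos _).le,
    ← ENNReal.ofReal_mul (Real.exp_pos _).le, ← Real.exp_nat_mul, ← Real.exp_add, ← Real.exp_add,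
    ENNReal.ofReal_le_ofReal_iff (Real.exp_pos _).le, Real.exp_le_exp] at key
  push_cast at key
  linarith

end Potential

/-! ### The noise of the Ornstein–Uhlenbeck process -/

/-- The `j`-th point of the subdivision of `[0, t]` into `k` intervals of equal length. -/
noncomputable def gridPoint (t : ℝ≥0) (k j : ℕ) : ℝ≥0 := j * (t / k)

lemma monotone_gridPoint (t : ℝ≥0) (k : ℕ) : Monotone (gridPoint t k) := fun i j hij => by
  unfold gridPoint; gcongr

lemma gridPoint_zero (t : ℝ≥0) (k : ℕ) : gridPoint t k 0 = 0 := by simp [gridPoint]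

lemma gridPoint_self (t : ℝ≥0) {k : ℕ} (hk : k ≠ 0) : gridPoint t k k = t := by
  unfold gridPoint; field_simp

lemma gridPoint_succ_sub (t : ℝ≥0) (k j : ℕ) :
    (gridPoint t k (j + 1) : ℝ) - gridPoint t k j = t / k := by
  simp only [gridPoint]; push_cast; ring

/-- The discretization of the Wiener integral `∫₀ᵗ exp (r / 2) dw_r`. -/
noncomputable def noiseSum {E : Type*} [AddCommGroup E] [Module ℝ E] (w : ℝ≥0 → E) (t : ℝ≥0)
    (k : ℕ) : E :=
  ∑ j ∈ Finset.range k,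
    Real.exp ((gridPoint t k j : ℝ) / 2) • (w (gridPoint t k (j + 1)) - w (gridPoint t k j))

section Path

variable {E : Type*} [NormedAddCommGroup E] [NormedSpace ℝ E] [CompleteSpace E]

/-- One step of the discretized variation-of-constants formula. -/
lemma exp_smul_sub_sub_step (y : ℝ → E) (hy : Continuous y) (r r' : ℝ) :
    Real.exp (r' / 2) • y r' - Real.exp (r / 2) • y r -
        Real.exp (r / 2) • (y r' - y r + (1 / 2 : ℝ) • ∫ s in r..r', y s) =
      (1 / 2 : ℝ) • ∫ s in r..r', (Real.exp (s / 2) • y r' - Real.exp (r / 2) • y s) := by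
  have hexp : ∫ s in r..r', Real.exp (s / 2) = 2 * (Real.exp (r' / 2) - Real.exp (r / 2)) := by
    rw [intervalIntegral.integral_comp_div (fun s => Real.exp s) two_ne_zero, integral_exp]
    simp
  rw [intervalIntegral.integral_sub
    (Continuous.intervalIntegrable (by fun_prop) _ _)
    (Continuous.intervalIntegrable (by fun_prop) _ _), intervalIntegral.integral_smul_const,
    intervalIntegral.integral_smul, hexp]
  module

/-- Pathwise, the discretized noise converges to the noise in the variation-of-constants
formula. The equation expresses increments of `w` through `x`, and the errors of the steps are
controlled by the uniform continuity of `(r, s) ↦ exp (r / 2) • x s`. -/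
lemma tendsto_noiseSum {x w : ℝ≥0 → E} (hx : Continuous x)
    (heq : ∀ t : ℝ≥0, x t = x 0 - (1 / 2 : ℝ) • (∫ s in (0 : ℝ)..t, x s.toNNReal) + w t)
    (t : ℝ≥0) :
    Filter.Tendsto (noiseSum w t) Filter.atTop (nhds (Real.exp ((t : ℝ) / 2) • x t - x 0)) := by
  set y : ℝ → E := fun s => x s.toNNReal with hy
  have hyc : Continuous y := hx.comp continuous_real_toNNReal
  have hxy : ∀ r : ℝ≥0, x r = y r := fun r => by simp [hy]
  have hw : ∀ r r' : ℝ≥0, w r' - w r = y r' - y r + (1 / 2 : ℝ) • ∫ s in (r : ℝ)..r', y s := by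
    intro r r'
    have h1 := heq r
    have h2 := heq r'
    have h3 := intervalIntegral.integral_add_adjacent_intervals
      (hyc.intervalIntegrable (μ := volume) (0 : ℝ) (r : ℝ))
      (hyc.intervalIntegrable (μ := volume) (r : ℝ) (r' : ℝ))
    rw [hxy] at h1 h2
    change _ = _ - (1 / 2 : ℝ) • (∫ s in (0 : ℝ)..r, y s) + _ at h1
    change _ = _ - (1 / 2 : ℝ) • (∫ s in (0 : ℝ)..r', y s) + _ at h2
    rw [← h3] at h2
    rw [h1, h2]
    module
  rw [Metric.tendsto_atTop]
  intro ε hε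
  have hu : UniformContinuousOn (fun p : ℝ × ℝ => Real.exp (p.1 / 2) • y p.2)
      (Set.Icc 0 (t : ℝ) ×ˢ Set.Icc 0 (t : ℝ)) :=
    (isCompact_Icc.prod isCompact_Icc).uniformContinuousOn_of_continuous
      (Continuous.continuousOn (by fun_prop))
  rw [Metric.uniformContinuousOn_iff] at hu
  obtain ⟨η, hη, hηε⟩ : ∃ η > 0, 1 / 2 * (η * t) < ε := by
    refine ⟨ε / (t + 1), by positivity, ?_⟩
    have : ε / (t + 1) * t ≤ ε := by
      rw [div_mul_eq_mul_div, div_le_iff₀ (by positivity)]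
      nlinarith [t.coe_nonneg]
    linarith
  obtain ⟨δ, hδ, hu⟩ := hu η hη
  obtain ⟨N, hN⟩ := exists_nat_gt ((t : ℝ) / δ)
  refine ⟨N + 1, fun k hk => ?_⟩
  have hk0 : k ≠ 0 := by omega
  have hkpos : (0 : ℝ) < k := by positivity
  have hmesh : (t : ℝ) / k < δ := by
    rw [div_lt_iff₀ hδ] at hN
    rw [div_lt_iff₀ hkpos]
    have : (N : ℝ) ≤ k := by exact_mod_cast (by omega : N ≤ k)
    nlinarith
  have htel : Real.exp ((t : ℝ) / 2) • x t - x 0 - noiseSum w t k =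
      ∑ j ∈ Finset.range k, (1 / 2 : ℝ) •
        ∫ s in (gridPoint t k j : ℝ)..(gridPoint t k (j + 1) : ℝ),
          (Real.exp (s / 2) • y (gridPoint t k (j + 1)) -
            Real.exp ((gridPoint t k j : ℝ) / 2) • y s) := by
    have h1 := Finset.sum_range_sub
      (fun j => Real.exp ((gridPoint t k j : ℝ) / 2) • y (gridPoint t k j)) k
    simp only [gridPoint_zero, gridPoint_self t hk0, NNReal.coe_zero, zero_div, Real.exp_zero,
      one_smul] at h1
    rw [hxy t, hxy 0, NNReal.coe_zero, ← h1, noiseSum, ← Finset.sum_sub_distrib]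
    refine Finset.sum_congr rfl fun j _ => ?_
    rw [hw, exp_smul_sub_sub_step y hyc]
  rw [dist_comm, dist_eq_norm, htel]
  refine lt_of_le_of_lt (norm_sum_le _ _) (lt_of_le_of_lt ?_ hηε)
  have hterm : ∀ j ∈ Finset.range k, ‖(1 / 2 : ℝ) •
        ∫ s in (gridPoint t k j : ℝ)..(gridPoint t k (j + 1) : ℝ),
          (Real.exp (s / 2) • y (gridPoint t k (j + 1)) -
            Real.exp ((gridPoint t k j : ℝ) / 2) • y s)‖ ≤ 1 / 2 * (η * (t / k)) := by
    intro j hj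
    have hj' : j + 1 ≤ k := Finset.mem_range.1 hj
    have hle : (gridPoint t k (j + 1) : ℝ) ≤ t := by
      have := monotone_gridPoint t k hj'
      rw [gridPoint_self t hk0] at this
      exact_mod_cast this
    have hstep := gridPoint_succ_sub t k j
    have hmk : (0 : ℝ) ≤ t / k := by positivity
    have h0 : (0 : ℝ) ≤ gridPoint t k j := NNReal.coe_nonneg _
    rw [norm_smul, Real.norm_of_nonneg (by norm_num : (0 : ℝ) ≤ 1 / 2)]
    refine mul_le_mul_of_nonneg_left ?_ (by norm_num)
    refine (intervalIntegral.norm_integral_le_of_norm_le_const (C := η) fun s hs => ?_).trans_eq ?_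
    · rw [Set.uIoc_of_le (by linarith)] at hs
      rw [← dist_eq_norm]
      refine (hu (s, (gridPoint t k (j + 1) : ℝ)) ?_ ((gridPoint t k j : ℝ), s) ?_ ?_).le
      · exact ⟨⟨by linarith [hs.1], by linarith [hs.2]⟩, by simp, hle⟩
      · exact ⟨⟨h0, by simp only; linarith⟩, by linarith [hs.1], by linarith [hs.2]⟩
      · rw [Prod.dist_eq, max_lt_iff, Real.dist_eq, Real.dist_eq, abs_lt, abs_lt]
        simp only
        constructor <;> constructor <;> linarith [hs.1, hs.2]
    · rw [hstep, abs_of_nonneg hmk]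
  refine (Finset.sum_le_card_nsmul _ _ _ hterm).trans_eq ?_
  rw [Finset.card_range, nsmul_eq_mul]
  field_simp

end Path

/-- The variance of each coordinate of the discretized noise. -/
noncomputable def noiseVar (t : ℝ≥0) (k : ℕ) : ℝ :=
  ∑ j ∈ Finset.range k, Real.exp (gridPoint t k j) * (t / k)

lemma tendsto_noiseVar {t : ℝ≥0} (ht : 0 < t) :
    Filter.Tendsto (noiseVar t) Filter.atTop (nhds (Real.exp t - 1)) := by
  have ht' : (0 : ℝ) < t := ht
  have h1 : Filter.Tendsto (fun k : ℕ => (t : ℝ) / k) Filter.atTop (nhdsWithin 0 {0}ᶜ) := by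
    rw [tendsto_nhdsWithin_iff]
    refine ⟨tendsto_const_div_atTop_nhds_zero_nat _, ?_⟩
    filter_upwards [Filter.eventually_gt_atTop 0] with k hk
    have : (0 : ℝ) < k := by exact_mod_cast hk
    simp only [Set.mem_compl_iff, Set.mem_singleton_iff]
    positivity
  have h2 : Filter.Tendsto (fun h : ℝ => h⁻¹ • (Real.exp (0 + h) - Real.exp 0))
      (nhdsWithin 0 {0}ᶜ) (nhds 1) := by
    simpa only [Real.exp_zero] using (Real.hasDerivAt_exp 0).tendsto_slope_zero
  have h3 := ((h2.comp h1).inv₀ one_ne_zero).const_mul (Real.exp t - 1)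
  rw [inv_one, mul_one] at h3
  refine h3.congr' ?_
  filter_upwards [Filter.eventually_gt_atTop 0] with k hk
  have hk' : (0 : ℝ) < k := by exact_mod_cast hk
  have hne : Real.exp ((t : ℝ) / k) ≠ 1 := by
    rw [Ne, Real.exp_eq_one_iff]; positivity
  -- the Riemann sum of the exponential over a regular grid is a geometric sum
  have hgeom : noiseVar t k = (∑ j ∈ Finset.range k, Real.exp ((t : ℝ) / k) ^ j) * (t / k) := by
    rw [noiseVar, Finset.sum_mul]
    refine Finset.sum_congr rfl fun j _ => ?_
    rw [← Real.exp_nat_mul]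
    simp [gridPoint]
  rw [hgeom, geom_sum_eq hne, ← Real.exp_nat_mul, mul_div_cancel₀ _ hk'.ne']
  simp only [Function.comp, zero_add, Real.exp_zero, smul_eq_mul, mul_inv, inv_inv]
  ring

section CharFun

variable {Ω : Type*} [MeasurableSpace Ω] {P : Measure Ω}

lemma charFun_noiseSum_real {B : ℝ≥0 → Ω → ℝ} (hB : IsPreBrownianReal B P) (t : ℝ≥0) (k : ℕ)
    (u : ℝ) :
    charFun (P.map fun ω => noiseSum (fun r => B r ω) t k) u =
      Complex.exp (-(noiseVar t k * u ^ 2 / 2 : ℝ)) := by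
  have hm := hB.aemeasurable
  have hind := (hB.hasIndepIncrements.nat (monotone_gridPoint t k)).comp
    (fun j (z : ℝ) => Real.exp ((gridPoint t k j : ℝ) / 2) * z) (fun j => by fun_prop)
  have hind' := hind.precomp (g := ((↑) : Finset.range k → ℕ)) Subtype.val_injective
  have h := iIndepFun.charFun_map_fun_finsetSum_eq_prod (s := Finset.range k)
    (X := fun j ω => Real.exp ((gridPoint t k j : ℝ) / 2) *
      (B (gridPoint t k (j + 1)) ω - B (gridPoint t k j) ω)) (P := P) (by fun_prop) hind'
  simp only [noiseSum, smul_eq_mul]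
  rw [h, Finset.prod_apply, noiseVar, Finset.sum_mul, Finset.sum_div, Complex.ofReal_sum,
    ← Finset.sum_neg_distrib, Complex.exp_sum]
  refine Finset.prod_congr rfl fun j _ => ?_
  rw [charFun_map_mul_comp (by fun_prop)]
  have hl := (hB.hasLaw_sub (gridPoint t k (j + 1)) (gridPoint t k j)).map_eq
  have hd : ((nndist (gridPoint t k (j + 1)).1 (gridPoint t k j).1 : ℝ≥0) : ℝ) = t / k := by
    rw [coe_nndist, Real.dist_eq]
    change |(gridPoint t k (j + 1) : ℝ) - (gridPoint t k j : ℝ)| = _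
    rw [gridPoint_succ_sub, abs_of_nonneg (by positivity)]
  change charFun (P.map (B (gridPoint t k (j + 1)) - B (gridPoint t k j))) _ = _
  rw [hl, charFun_gaussianReal]
  congr 1
  rw [show ((nndist (gridPoint t k (j + 1)).1 (gridPoint t k j).1 : ℝ≥0) : ℂ) =
    ((nndist (gridPoint t k (j + 1)).1 (gridPoint t k j).1 : ℝ≥0) : ℝ) from rfl, hd]
  have he : Real.exp (gridPoint t k j) = Real.exp ((gridPoint t k j : ℝ) / 2) ^ 2 := by
    rw [← Real.exp_nat_mul]; congr 1; push_cast; ring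
  rw [he]
  push_cast
  ring

variable {n : ℕ} {W : ℝ≥0 → Ω → EuclideanSpace ℝ (Fin n)}

lemma noiseSum_apply (w : ℝ≥0 → EuclideanSpace ℝ (Fin n)) (t : ℝ≥0) (k : ℕ) (i : Fin n) :
    noiseSum w t k i = noiseSum (fun r => w r i) t k := by
  simp [noiseSum]

lemma measurable_noiseSum {E : Type*} [NormedAddCommGroup E] [NormedSpace ℝ E]
    [MeasurableSpace E] [BorelSpace E] [SecondCountableTopology E] (t : ℝ≥0) (k : ℕ) :
    Measurable fun w : ℝ≥0 → E => noiseSum w t k := by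
  unfold noiseSum; fun_prop

lemma charFun_noiseSum [IsProbabilityMeasure P] (hW : IsBrownianVec W P) (t : ℝ≥0) (k : ℕ)
    (u : EuclideanSpace ℝ (Fin n)) :
    charFun (P.map fun ω => noiseSum (fun r => W r ω) t k) u =
      Complex.exp (-(noiseVar t k * ‖u‖ ^ 2 / 2 : ℝ)) := by
  have hm : ∀ i, Measurable fun ω => noiseSum (fun r => W r ω i) t k := fun i => by
    have := hW.measurable
    unfold noiseSum
    fun_prop
  have hind := hW.indep.comp (fun _ w => noiseSum w t k) fun _ => measurable_noiseSum t k
  have h := (iIndepFun_iff_charFun_pi (X := fun i ω => noiseSum (fun r => W r ω i) t k)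
    fun i => (hm i).aemeasurable).1 hind u
  have he : (fun ω => noiseSum (fun r => W r ω) t k) =
      fun ω => WithLp.toLp 2 fun i => noiseSum (fun r => W r ω i) t k := by
    ext ω i
    rw [noiseSum_apply]
  rw [he, h]
  simp only [charFun_noiseSum_real (hW.coord _).toIsPreBrownianReal]
  rw [← Complex.exp_sum, EuclideanSpace.norm_sq_eq]
  congr 1
  push_cast
  rw [Finset.mul_sum, Finset.sum_div, ← Finset.sum_neg_distrib]
  refine Finset.sum_congr rfl fun i _ => ?_
  rw [← Complex.ofReal_pow, ← Complex.ofReal_pow, Real.norm_eq_abs, sq_abs]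

end CharFun

/-! ### The law of the Ornstein–Uhlenbeck process -/

section OrnsteinUhlenbeck

variable {n : ℕ} {Ω : Type*} [MeasurableSpace Ω] {P : Measure Ω} [IsProbabilityMeasure P]
  {X W : ℝ≥0 → Ω → EuclideanSpace ℝ (Fin n)} {p₀ : EuclideanSpace ℝ (Fin n) → ℝ}

omit [IsProbabilityMeasure P] in
lemma IsOrnsteinUhlenbeck.tendsto_noiseSum (hX : IsOrnsteinUhlenbeck X W p₀ P) (t : ℝ≥0) :
    ∀ᵐ ω ∂P, Filter.Tendsto
      (fun k => Real.exp (-(t : ℝ) / 2) • (X 0 ω + noiseSum (fun r => W r ω) t k))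
      Filter.atTop (nhds (X t ω)) := by
  filter_upwards [hX.continuous_path, hX.equation] with ω hc he
  have h := ((_root_.tendsto_noiseSum hc he t).const_add (X 0 ω)).const_smul
    (Real.exp (-(t : ℝ) / 2))
  have he0 : Real.exp (-(t : ℝ) / 2) * Real.exp ((t : ℝ) / 2) = 1 := by
    rw [← Real.exp_add, neg_div, neg_add_cancel, Real.exp_zero]
  rwa [add_sub_cancel, smul_smul, he0, one_smul] at h

lemma tendsto_charFun_map_of_ae_tendsto {E : Type*} [NormedAddCommGroup E] [InnerProductSpace ℝ E]
    [MeasurableSpace E] [BorelSpace E] [SecondCountableTopology E] {Y : ℕ → Ω → E} {Z : Ω → E}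
    (hY : ∀ k, Measurable (Y k)) (hZ : Measurable Z)
    (h : ∀ᵐ ω ∂P, Filter.Tendsto (fun k => Y k ω) Filter.atTop (nhds (Z ω))) (u : E) :
    Filter.Tendsto (fun k => charFun (P.map (Y k)) u) Filter.atTop
      (nhds (charFun (P.map Z) u)) := by
  have hc : Continuous fun z : E => Complex.exp ((inner ℝ z u : ℝ) * Complex.I) := by fun_prop
  have he : ∀ V : Ω → E, Measurable V →
      charFun (P.map V) u = ∫ ω, Complex.exp ((inner ℝ (V ω) u : ℝ) * Complex.I) ∂P :=
    fun V hV => by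
      rw [charFun_apply, integral_map hV.aemeasurable hc.aestronglyMeasurable]
  simp only [he _ (hY _), he Z hZ]
  refine tendsto_integral_of_dominated_convergence (fun _ => 1)
    (fun k => (hc.measurable.comp (hY k)).aestronglyMeasurable) (integrable_const _)
    (fun k => .of_forall fun ω => by rw [Complex.norm_exp_ofReal_mul_I]) ?_
  filter_upwards [h] with ω hω
  exact (hc.tendsto _).comp hω

omit [IsProbabilityMeasure P] in
lemma IsOrnsteinUhlenbeck.measurable_noiseSum (hX : IsOrnsteinUhlenbeck X W p₀ P) (t : ℝ≥0)
    (k : ℕ) : Measurable fun ω => noiseSum (fun r => W r ω) t k := by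
  have := hX.brownian.measurable
  unfold noiseSum
  fun_prop

omit [IsProbabilityMeasure P] in
lemma IsOrnsteinUhlenbeck.indepFun_noiseSum (hX : IsOrnsteinUhlenbeck X W p₀ P) (t : ℝ≥0)
    (k : ℕ) : IndepFun (X 0) (fun ω => noiseSum (fun r => W r ω) t k) P :=
  hX.initial_indep.comp (φ := id) (ψ := fun w => noiseSum w t k) measurable_id
    (_root_.measurable_noiseSum t k)

lemma IsOrnsteinUhlenbeck.charFun_map_smul_add_noiseSum (hX : IsOrnsteinUhlenbeck X W p₀ P)
    (t : ℝ≥0) (k : ℕ) (a : ℝ) (u : EuclideanSpace ℝ (Fin n)) :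
    charFun (P.map fun ω => a • (X 0 ω + noiseSum (fun r => W r ω) t k)) u =
      charFun (P.map (X 0)) (a • u) *
        Complex.exp (-(noiseVar t k * ‖a • u‖ ^ 2 / 2 : ℝ)) := by
  have hN := hX.measurable_noiseSum t k
  have hX0 := hX.measurable 0
  have hadd : Measurable fun ω => X 0 ω + noiseSum (fun r => W r ω) t k := hX0.add hN
  rw [charFun_map_smul_comp hadd.aemeasurable,
    (hX.indepFun_noiseSum t k).charFun_map_fun_add_eq_mul hX0.aemeasurable hN.aemeasurable,
    Pi.mul_apply, charFun_noiseSum hX.brownian]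

lemma IsOrnsteinUhlenbeck.charFun_map (hX : IsOrnsteinUhlenbeck X W p₀ P) {t : ℝ≥0} (ht : 0 < t)
    (u : EuclideanSpace ℝ (Fin n)) :
    charFun (P.map (X t)) u = charFun (P.map (X 0)) (Real.exp (-(t : ℝ) / 2) • u) *
      Complex.exp (-((1 - Real.exp (-(t : ℝ))) * ‖u‖ ^ 2 / 2 : ℝ)) := by
  have h := tendsto_charFun_map_of_ae_tendsto
    (Y := fun k ω => Real.exp (-(t : ℝ) / 2) • (X 0 ω + noiseSum (fun r => W r ω) t k))
    (fun k => by
      have hadd : Measurable fun ω => X 0 ω + noiseSum (fun r => W r ω) t k :=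
        (hX.measurable 0).add (hX.measurable_noiseSum t k)
      exact hadd.const_smul (Real.exp (-(t : ℝ) / 2)))
    (hX.measurable t) (hX.tendsto_noiseSum t) u
  simp only [hX.charFun_map_smul_add_noiseSum] at h
  refine tendsto_nhds_unique h (Filter.Tendsto.const_mul _ ?_)
  have hc : Continuous fun v : ℝ => Complex.exp
      (-(v * ‖Real.exp (-(t : ℝ) / 2) • u‖ ^ 2 / 2 : ℝ)) := by fun_prop
  have he : (1 - Real.exp (-(t : ℝ))) * ‖u‖ ^ 2 =
      (Real.exp t - 1) * ‖Real.exp (-(t : ℝ) / 2) • u‖ ^ 2 := by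
    rw [norm_smul, mul_pow, Real.norm_of_nonneg (Real.exp_pos _).le, ← Real.exp_nat_mul,
      show ((2 : ℕ) : ℝ) * (-(t : ℝ) / 2) = -t by push_cast; ring]
    have : Real.exp t * Real.exp (-(t : ℝ)) = 1 := by rw [← Real.exp_add]; simp
    linear_combination -‖u‖ ^ 2 * this
  rw [he]
  exact (hc.tendsto _).comp (tendsto_noiseVar ht)

/-- The law of an Ornstein–Uhlenbeck process at time `t > 0`, given by Mehler's formula. -/
lemma IsOrnsteinUhlenbeck.map_eq (hX : IsOrnsteinUhlenbeck X W p₀ P) {t : ℝ≥0} (ht : 0 < t) :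
    P.map (X t) = volume.withDensity fun x => ENNReal.ofReal
      (smoothedDensity (P.map (X 0)) (Real.exp (-(t : ℝ) / 2)) (1 - Real.exp (-(t : ℝ))) x) := by
  have hs : 0 < 1 - Real.exp (-(t : ℝ)) := by
    have : (0 : ℝ) < t := ht
    simpa
  have := Measure.isProbabilityMeasure_map (hX.measurable 0).aemeasurable (μ := P)
  have := Measure.isProbabilityMeasure_map (hX.measurable t).aemeasurable (μ := P)
  have := isProbabilityMeasure_heatMeasure (n := n) hs
  rw [withDensity_smoothedDensity hs]
  have : IsProbabilityMeasure ((P.map (X 0)).map fun y => Real.exp (-(t : ℝ) / 2) • y) :=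
    Measure.isProbabilityMeasure_map (by fun_prop)
  refine Measure.ext_of_charFun (funext fun u => ?_)
  rw [charFun_conv, charFun_map_smul, charFun_heatMeasure hs, hX.charFun_map ht]

end OrnsteinUhlenbeck

/-- Continuous nonnegative densities of the same measure agree at every point. -/
lemma eq_of_withDensity_ofReal_eq {E : Type*} [TopologicalSpace E] [MeasurableSpace E]
    [BorelSpace E] {μ : Measure E} [SigmaFinite μ] [μ.IsOpenPosMeasure] {f g : E → ℝ}
    (hf : Continuous f) (hg : Continuous g) (hf0 : ∀ x, 0 ≤ f x) (hg0 : ∀ x, 0 ≤ g x)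
    (h : (μ.withDensity fun x => ENNReal.ofReal (f x)) =
      μ.withDensity fun x => ENNReal.ofReal (g x)) : f = g := by
  have hfm := hf.measurable
  have hgm := hg.measurable
  have hae := (withDensity_eq_iff_of_sigmaFinite (by fun_prop) (by fun_prop)).1 h
  have he := (Continuous.ae_eq_iff_eq μ (ENNReal.continuous_ofReal.comp hf)
    (ENNReal.continuous_ofReal.comp hg)).1 hae
  funext x
  exact (ENNReal.ofReal_eq_ofReal_iff (hf0 x) (hg0 x)).1 (congrFun he x)

/-! ### The Hessian bounds -/

/-- Below the time horizon, the Gaussian noise of variance `1 - exp (-t)` is small enough for the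
Gaussian kernel to compensate the concavity of the potential. -/
lemma mul_one_sub_exp_neg_lt_one {M t : ℝ} (hM : 0 ≤ M)
    (h : 1 < M → t < -Real.log (1 - 1 / M)) : M * (1 - Real.exp (-t)) < 1 := by
  rcases le_or_gt M 1 with h1 | h1
  · rcases hM.eq_or_lt with rfl | hM0
    · simp
    · nlinarith [mul_pos hM0 (Real.exp_pos (-t))]
  · have hM0 : 0 < M := by linarith
    have h2 : 0 < 1 - 1 / M := by
      rw [sub_pos, div_lt_one hM0]; exact h1
    have h3 : 1 - 1 / M < Real.exp (-t) := (Real.log_lt_iff_lt_exp h2).1 (by linarith [h h1])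
    calc M * (1 - Real.exp (-t)) < M * (1 / M) := by gcongr; linarith
      _ = 1 := by field_simp

theorem theorem3p1 {n : ℕ} {Ω : Type*} [MeasurableSpace Ω] (P : Measure Ω)
    [IsProbabilityMeasure P] (X W : ℝ≥0 → Ω → EuclideanSpace ℝ (Fin n))
    (p₀ : EuclideanSpace ℝ (Fin n) → ℝ) (hpos : ∀ x, 0 < p₀ x)
    (hg : ContDiff ℝ 2 (scorePotential p₀)) (hX : IsOrnsteinUhlenbeck X W p₀ P) :
    (∃ p : ℝ≥0 → EuclideanSpace ℝ (Fin n) → ℝ, IsMarginalDensity p X P) ∧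
    ∀ p : ℝ≥0 → EuclideanSpace ℝ (Fin n) → ℝ, IsMarginalDensity p X P →
      (∀ t x, 0 < p t x) ∧
      (∀ t, ContDiff ℝ 2 (scorePotential (p t))) ∧
      (∀ M₁ : ℝ, (∀ x, hessian (scorePotential p₀) x ≤ M₁ • 1) →
        ∀ t x, hessian (scorePotential (p t)) x ≤ (Real.exp (-(t : ℝ)) * M₁) • 1) ∧
      (∀ M₀ : ℝ, 0 ≤ M₀ → (∀ x, (-M₀) • 1 ≤ hessian (scorePotential p₀) x) →
        ∀ t : ℝ≥0, (1 < M₀ → (t : ℝ) < -Real.log (1 - 1 / M₀)) →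
          ∀ x, (-(M₀ / (Real.exp (t : ℝ) - M₀ * (Real.exp (t : ℝ) - 1)))) • 1 ≤
            hessian (scorePotential (p t)) x) := by
  have hp₀ : Continuous p₀ := continuous_of_continuous_scorePotential hpos hg.continuous
  set μ := volume.withDensity fun x => ENNReal.ofReal (p₀ x) with hμ
  have hX0 : P.map (X 0) = μ := hX.initial_law.map_eq
  have hprob : IsProbabilityMeasure μ :=
    hX0 ▸ Measure.isProbabilityMeasure_map (hX.measurable 0).aemeasurable
  set a : ℝ≥0 → ℝ := fun t => Real.exp (-(t : ℝ) / 2)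
  set s : ℝ≥0 → ℝ := fun t => 1 - Real.exp (-(t : ℝ))
  have ha : ∀ t, a t ^ 2 = Real.exp (-(t : ℝ)) := fun t => by
    simp only [a]; rw [← Real.exp_nat_mul]; congr 1; push_cast; ring
  have has : ∀ t, a t ^ 2 + s t = 1 := fun t => by rw [ha]; simp only [s]; ring
  have hs : ∀ t : ℝ≥0, 0 < t → 0 < s t := fun t ht => by
    have : (0 : ℝ) < t := ht
    simpa [s]
  have hmap : ∀ t : ℝ≥0, 0 < t → P.map (X t) =
      volume.withDensity fun x => ENNReal.ofReal (smoothedDensity μ (a t) (s t) x) :=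
    fun t ht => by rw [← hX0]; exact hX.map_eq ht
  refine ⟨⟨fun t => if t = 0 then p₀ else smoothedDensity μ (a t) (s t), ?_, ?_, ?_⟩, ?_⟩
  · intro t
    split_ifs with h
    · exact hp₀
    · exact (contDiff_smoothedDensity (hs t (pos_of_ne_zero h))).continuous
  · intro t x
    split_ifs with h
    · exact (hpos x).le
    · exact (smoothedDensity_pos (hs t (pos_of_ne_zero h)) x).le
  · intro t
    refine ⟨(hX.measurable t).aemeasurable, ?_⟩
    rcases eq_or_ne t 0 with rfl | h
    · simpa using hX0
    · simpa only [if_neg h] using hmap t (pos_of_ne_zero h)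
  · intro p hp
    have h0 : p 0 = p₀ := eq_of_withDensity_ofReal_eq (hp.continuous 0) hp₀ (hp.nonneg 0)
      (fun x => (hpos x).le) ((hp.law 0).map_eq.symm.trans hX0)
    have ht : ∀ t : ℝ≥0, 0 < t → p t = smoothedDensity μ (a t) (s t) := fun t h =>
      eq_of_withDensity_ofReal_eq (hp.continuous t)
        (contDiff_smoothedDensity (hs t h)).continuous (hp.nonneg t)
        (fun x => (smoothedDensity_pos (hs t h) x).le)
        ((hp.law t).map_eq.symm.trans (hmap t h))
    have hppos : ∀ t x, 0 < p t x := fun t x => by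
      rcases eq_zero_or_pos t with rfl | h
      · rw [h0]; exact hpos x
      · rw [ht t h]; exact smoothedDensity_pos (hs t h) x
    have hC2 : ∀ t, ContDiff ℝ 2 (scorePotential (p t)) := fun t => by
      rcases eq_zero_or_pos t with rfl | h
      · rw [h0]; exact hg
      · rw [ht t h]
        exact contDiff_scorePotential (contDiff_smoothedDensity (hs t h))
          (smoothedDensity_pos (hs t h))
    refine ⟨hppos, hC2, fun M₁ hM₁ t => ?_, fun M₀ hM₀ hM t hlt => ?_⟩
    · rcases eq_zero_or_pos t with rfl | h
      · simpa [h0] using hM₁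
      · rw [forall_hessian_le_iff (hC2 t), ← ha]
        exact scorePotential_smoothedDensity_second_difference_le hpos hg.continuous (hs t h)
          (has t) ((forall_hessian_le_iff hg).1 hM₁) (by rw [ht t h])
    · rcases eq_zero_or_pos t with rfl | h
      · simpa [h0] using hM
      · have hMs : M₀ * s t < 1 := mul_one_sub_exp_neg_lt_one hM₀ hlt
        have hK : M₀ / (Real.exp t - M₀ * (Real.exp t - 1)) =
            M₀ * a t ^ 2 / (1 - M₀ * s t) := by
          have e : Real.exp t - M₀ * (Real.exp t - 1) = Real.exp t * (1 - M₀ * s t) := by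
            simp only [s, Real.exp_neg]
            field_simp
          rw [e, ha, Real.exp_neg]
          have : 1 - M₀ * s t ≠ 0 := by linarith
          field_simp
        rw [hK, forall_le_hessian_iff (hC2 t)]
        exact le_scorePotential_smoothedDensity_second_difference hpos hg.continuous (hs t h)
          (has t) hMs ((forall_le_hessian_iff hg).1 hM) (by rw [ht t h])
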